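/- **Setting.** Let $2\le m\le m'\le n-1$, fix a sign $\pm$, and let $\Lambda=\sum_{i=1}^{n+1}\Lambda_ie_i\in\Xi_{m,\pm}$ be a Harish-Chandra parameter of $Spin(2n,2)$: its coordinates are all integers or all half-integers, and $\Lambda_1>\dots>\Lambda_{m-1}>\pm\Lambda_{n+1}>\Lambda_m>\dots>\Lambda_{n-1}>|\Lambda_n|$, $\pm\Lambda_{n+1}>|\Lambda_n|$. Let $\lambda_i=\Lambda_i-n+i+1$ for $i<m$ and $\lambda_i=\Lambda_i-n+i$ for $m\le i\le n$ (Blattner parameter), and let $GT(\lambda)$ be the set of Gelfand–Tsetlin patterns $Q=(q_{i,j})_{1\le i\le 2n-1,\,1\le j\le\lfloor (i+1)/2\rfloor}$ of $Spin(2n)$ with top row $q_{2n-1,j}=\lambda_j$. For $j>0$ put $l_{2i-1,j}=q_{2i-1,j}+i-j$, $l_{2i-1,-j}=-l_{2i-1,j}$, $l_{2i,j}=q_{2i,j}+i+1-j$, $l_{2i,-j}=-l_{2i,j}+1$. For $\mu\in[m-1,n-1]$ let $\mathcal C_\mu$ be the set of $Q\in GT(\lambda)$ such that * $q_{2n-2,p}=q_{2n-3,p}=q_{2n-4,p}$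 for $1\le p\le m-2$; * $\lambda_k\ge q_{2n-4,k}\ge\lambda_{k+1}$ for $1\le k\le m-2$, $\lambda_{k+1}\ge q_{2n-4,k}\ge\lambda_{k+2}$ for $m-1\le k\le n-3$, and $\lambda_{n-1}\ge q_{2n-4,n-2}\ge|\lambda_n|$; * $q_{2n-2,p}=\lambda_{p+1}$, $q_{2n-3,p}=q_{2n-4,p}$ for $m-1\le p\le\mu-1$; $q_{2n-2,p}=\lambda_p$, $q_{2n-3,p}=q_{2n-4,p-1}$ for $\mu+1\le p\le n-1$; * $q_{2n-2,\mu}=q_{2n-3,\mu}$, lying in $[\lambda_{\mu+1},q_{2n-4,\mu-1}]$ if $\mu\ge m$ and in $[\lambda_m,\lambda_{m-1}]$ if $\mu=m-1$. Let $Q_{m'}^+\in\mathcal C_{m'}$ be the pattern with $q_{2n-2,m'}=q_{2n-4,m'-1}$, and $Q_{m'-1}^-\in\mathcal C_{m'-1}$ the pattern with $q_{2n-2,m'-1}=\lambda_{m'}$, having the same rows $1,\dots,2n-4$ as $Q_{m'}^+$. Assume $\lambda_{m'}>q_{2n-4,m'-1}$ (equivalently $Q_{m'-1}^-\ne Q_{m'}^+$).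 **Exponents.** For $Q\in\mathcal C_\mu$ let $K_6(\mu)(Q)$ be the set of $j\in[m-1,\mu]\cup[-n+1,-\mu]$ such that adding $\operatorname{sgn}j$ to $q_{2n-2,|j|}$ gives an element of $GT(\lambda)$. Let $j_3<\dots<j_{N_1}$ be the elements of $K_6(\mu)\cap[m,\mu]$, and let $k_{N_1+1},\dots,k_{N_2}$ be those of $K_6(\mu)\cap[-n+1,-\mu-1]$, normally in increasing order. Put $x=\pm\Lambda_{n+1}$, $y=l_{2n-2,m-1}-1$; $(\alpha_1,\alpha_2)=(\pm\Lambda_n+x,\pm\Lambda_n+y)$ if $\mu\ge m$, and $(\pm\Lambda_n+\max\{x,y\},\pm\Lambda_n+\min\{x,y\})$ if $\mu=m-1$; further $\alpha_p=\pm\Lambda_n+l_{2n-2,j_p}-1$, $\beta_p=\pm\Lambda_n+l_{2n-3,j_p-1}$ for $3\le p\le N_1$, and $\alpha_p=\pm\Lambda_n+l_{2n-2,k_p}-1$, $\beta_p=\pm\Lambda_n+l_{2n-3,k_p}$ for $N_1<p\le N_2$. (All signs $\pm$ are the fixed one.) **Functions.** Let $C_j$ be a loop starting and ending at $+\infty$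 that crosses the real axis once, between $-\alpha_j-1$ and $-\alpha_j$, and encircles $[-\alpha_j,\infty)$ once in the negative direction. With the modified Bessel functions $K_\nu$, $I_\nu$ put $$\begin{Bmatrix}f_1^K\\ f_1^I\end{Bmatrix}(Q,\mu;t)=\frac1{2\pi\iota}\int_{C_1}\frac{\prod_{p=1}^{N_2}\Gamma(-\alpha_p-s)}{\prod_{p=3}^{N_2}\Gamma(1-\beta_p-s)}\begin{Bmatrix}t_2^sK_{-s}(t_1)\\(-t_2)^sI_{-s}(t_1)\end{Bmatrix}ds$$ and, for $2\le j\le N_2$, $$\begin{Bmatrix}f_j^K\\ f_j^I\end{Bmatrix}(Q,\mu;t)=\frac1{2\pi\iota}\int_{C_j}\frac{\prod_{p=j}^{N_2}\Gamma(-\alpha_p-s)\prod_{p=3}^{j}\Gamma(\beta_p+s)}{\prod_{p=1}^{j-1}\Gamma(1+\alpha_p+s)\prod_{p=j+1}^{N_2}\Gamma(1-\beta_p-s)}\begin{Bmatrix}(-t_2)^sK_{-s}(t_1)\\t_2^sI_{-s}(t_1)\end{Bmatrix}ds .$$ These are multivalued functions of $t_1\neq0$, $t_2\ne0$, read with any local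 holomorphic branches of $\log t_2$, $\log(-t_2)$ and any value of $\log t_1$. Put $\partial_{t_2}=t_2\,\partial/\partial t_2$ and $$S_2(m')=\prod_{q=q_{2n-4,m'-1}}^{\lambda_{m'}-1}(\partial_{t_2}\pm\Lambda_n-q-n+m')\qquad(q\text{ in unit steps}).$$ **Proposition.** Let $N_1,N_2$ be the numbers belonging to $(m',Q_{m'}^+)$, whose $k_p$ are numbered increasingly, and let $L=K$ or $I$. All integrals below converge absolutely, $f_j^L(Q_{m'}^+,m';t)$ is holomorphic in $t_2$ on the domain of the branches, and the "constants" do not depend on $t$ or on the branches. (a) Number the data of $Q_{m'-1}^-$ so that the new element $-m'$ of $K_6(m'-1)(Q_{m'-1}^-)$ occupies the place $N_1+1$, i.e. as $j_3,\dots,j_{N_1},-m',k_{N_1+1},\dots,k_{N_2}$. Then $S_2(m')f_j^L(Q_{m'}^+,m';t)$ is a non-zero constant multiple of 1. $f_j^L(Q_{m'-1}^-,m'-1;t)$ if $j=1,\dots,N_1$; 2. $f_{j+1}^L(Q_{m'-1}^-,m'-1;t)$ if $j=N_1+1,\dots,N_2$. (b) If instead the negative elements of $K_6(m'-1)(Q_{m'-1}^-)$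 are numbered increasingly (so that $-m'$ comes last), then $S_2(m')f_j^L(Q_{m'}^+,m';t)$ is a non-zero constant multiple of $f_j^L(Q_{m'-1}^-,m'-1;t)$ for every $j=1,\dots,N_2$. -/

import Mathlib

noncomputable section

namespace SpinWhittaker

/-! ### Discrete series parameters of `Spin(2n,2)`

Weights are written in the basis `e_1, …, e_{n+1}`; only the coordinates with index in `[1, n+1]`
of a function `ℕ → ℝ` are ever used.  The sign `±` is carried by `ε : ℤˣ`. -/

/-- The weight `e_i`. -/
def basisWeight (i : ℕ) : ℕ → ℝ := Pi.single i 1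

/-- The pairing `⟨Λ, β⟩` (up to a positive scalar). -/
def pairing (n : ℕ) (Λ β : ℕ → ℝ) : ℝ := ∑ i ∈ Finset.Icc 1 (n + 1), Λ i * β i

/-- The root system `Δ = {± e_i ± e_j | 1 ≤ i < j ≤ n + 1}`. -/
def rootSystem (n : ℕ) : Set (ℕ → ℝ) :=
  {β | ∃ i j : ℕ, 1 ≤ i ∧ i < j ∧ j ≤ n + 1 ∧
    ∃ s t : ℤˣ, β = ((s : ℤ) : ℝ) • basisWeight i + ((t : ℤ) : ℝ) • basisWeight j}

/-- The compact positive roots `Δ_c^+ = {e_i ± e_j | 1 ≤ i < j ≤ n}`. -/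
def compactPositive (n : ℕ) : Set (ℕ → ℝ) :=
  {β | ∃ i j : ℕ, 1 ≤ i ∧ i < j ∧ j ≤ n ∧
    ∃ t : ℤˣ, β = basisWeight i + ((t : ℤ) : ℝ) • basisWeight j}

/-- The positive system `Δ_{m,±}^+`, for `1 ≤ m ≤ n`. -/
def positiveSystem (n m : ℕ) (ε : ℤˣ) : Set (ℕ → ℝ) :=
  compactPositive n ∪
  {β | ∃ i : ℕ, 1 ≤ i ∧ i + 1 ≤ m ∧
    ∃ t : ℤˣ, β = basisWeight i + ((t : ℤ) : ℝ) • basisWeight (n + 1)} ∪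
  {β | ∃ i : ℕ, m ≤ i ∧ i ≤ n ∧
    ∃ t : ℤˣ, β = ((ε : ℤ) : ℝ) • basisWeight (n + 1) + ((t : ℤ) : ℝ) • basisWeight i}

/-- Harish-Chandra parameters: `Λ` is regular, `Δ_c^+`-dominant, and `Λ + ρ` is analytically
integral, i.e. its coordinates are all integers or all half-integers.  Here
`ρ = ∑ (n + 1 - i) e_i` is half the sum of the positive roots `e_i ± e_j`, `i < j`. -/
def IsHarishChandra (n : ℕ) (Λ : ℕ → ℝ) : Prop :=
  (∀ β ∈ rootSystem n, pairing n Λ β ≠ 0) ∧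
  (∀ β ∈ compactPositive n, 0 ≤ pairing n Λ β) ∧
  ((∀ i ∈ Finset.Icc 1 (n + 1), ∃ k : ℤ, Λ i + ((n : ℝ) + 1 - i) = k) ∨
   (∀ i ∈ Finset.Icc 1 (n + 1), ∃ k : ℤ, Λ i + ((n : ℝ) + 1 - i) = k + 1 / 2))

/-- The set `Ξ_{m,±}`, for `1 ≤ m ≤ n`. -/
def Xi (n m : ℕ) (ε : ℤˣ) : Set (ℕ → ℝ) :=
  {Λ | IsHarishChandra n Λ ∧ ∀ β ∈ positiveSystem n m ε, 0 ≤ pairing n Λ β}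

/-- The coordinates `λ_1, …, λ_n` of the Blattner parameter `Λ - ρ_c + ρ_n` of
`Λ ∈ Ξ_{m,±}`, `m ≤ n`. -/
def blattner (n m : ℕ) (Λ : ℕ → ℝ) (i : ℕ) : ℝ :=
  if i < m then Λ i - n + i + 1 else Λ i - n + i

/-! ### Gelfand–Tsetlin patterns -/

/-- `Q` is a `lam`-Gelfand–Tsetlin pattern for `Spin(2n)`; `Q i j` is the entry `q_{i,j}`, and only
`1 ≤ i ≤ 2n - 1`, `1 ≤ j ≤ ⌊(i + 1) / 2⌋` matter. -/
structure IsGT (n : ℕ) (lam : ℕ → ℝ) (Q : ℕ → ℕ → ℝ) : Prop where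
  integral :
    (∀ i ∈ Finset.Icc 1 (2 * n - 1), ∀ j ∈ Finset.Icc 1 ((i + 1) / 2), ∃ k : ℤ, Q i j = k) ∨
    (∀ i ∈ Finset.Icc 1 (2 * n - 1), ∀ j ∈ Finset.Icc 1 ((i + 1) / 2),
      ∃ k : ℤ, Q i j = k + 1 / 2)
  odd_even : ∀ i ∈ Finset.Icc 1 (n - 1), ∀ j ∈ Finset.Icc 1 (i - 1),
    Q (2 * i) j ≤ Q (2 * i + 1) j ∧ Q (2 * i + 1) (j + 1) ≤ Q (2 * i) j
  odd_even_last : ∀ i ∈ Finset.Icc 1 (n - 1),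
    Q (2 * i) i ≤ Q (2 * i + 1) i ∧ |Q (2 * i + 1) (i + 1)| ≤ Q (2 * i) i
  even_odd : ∀ i ∈ Finset.Icc 1 (n - 1), ∀ j ∈ Finset.Icc 1 (i - 1),
    Q (2 * i - 1) j ≤ Q (2 * i) j ∧ Q (2 * i) (j + 1) ≤ Q (2 * i - 1) j
  even_odd_last : ∀ i ∈ Finset.Icc 1 (n - 1),
    Q (2 * i - 1) i ≤ Q (2 * i) i ∧ -Q (2 * i) i ≤ Q (2 * i - 1) i
  top : ∀ j ∈ Finset.Icc 1 n, Q (2 * n - 1) j = lam j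

/-- The shift `σ_{a,b}`: add `sgn b` to the `|b|`-th entry of row `a`. -/
def shiftRow (a : ℕ) (b : ℤ) (Q : ℕ → ℕ → ℝ) : ℕ → ℕ → ℝ := fun i j =>
  if i = a ∧ j = b.natAbs then Q i j + (b.sign : ℝ) else Q i j

/-- `l_{2i-1,j}` for `j = ±1, …, ±i`. -/
def lOdd (i : ℕ) (Q : ℕ → ℕ → ℝ) (j : ℤ) : ℝ :=
  (j.sign : ℝ) * (Q (2 * i - 1) j.natAbs + i - j.natAbs)

/-- `l_{2i,j}` for `j = 0, ±1, …, ±i`. -/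
def lEven (i : ℕ) (Q : ℕ → ℕ → ℝ) (j : ℤ) : ℝ :=
  if 0 < j then Q (2 * i) j.natAbs + i + 1 - j.natAbs
  else if j < 0 then -(Q (2 * i) j.natAbs + i + 1 - j.natAbs) + 1
  else 0

/-- Rows `2n-2`, `2n-3`, `2n-4` agree in the places `1, …, m - 2`, the row `2n-4` interlaces with
`lam` as is needed for non-vanishing coefficients, and the places `m - 1, …, n - 1` of the rows
`2n-2`, `2n-3` are of "corner" shape with respect to `m'`. -/
structure IsCornerType (n m m' : ℕ) (lam : ℕ → ℝ) (Q : ℕ → ℕ → ℝ) : Prop where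
  isGT : IsGT n lam Q
  low : ∀ p ∈ Finset.Icc 1 (m - 2),
    Q (2 * n - 2) p = Q (2 * n - 3) p ∧ Q (2 * n - 3) p = Q (2 * n - 4) p
  row_low : ∀ k ∈ Finset.Icc 1 (m - 2),
    Q (2 * n - 4) k ≤ lam k ∧ lam (k + 1) ≤ Q (2 * n - 4) k
  row_high : ∀ k ∈ Finset.Icc (m - 1) (n - 3),
    Q (2 * n - 4) k ≤ lam (k + 1) ∧ lam (k + 2) ≤ Q (2 * n - 4) k
  row_last : Q (2 * n - 4) (n - 2) ≤ lam (n - 1) ∧ |lam n| ≤ Q (2 * n - 4) (n - 2)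
  left : ∀ p : ℕ, m - 1 ≤ p → p < m' →
    Q (2 * n - 2) p = lam (p + 1) ∧ Q (2 * n - 3) p = Q (2 * n - 4) p
  right : ∀ p ∈ Finset.Icc (m' + 1) (n - 1),
    Q (2 * n - 2) p = lam p ∧ Q (2 * n - 3) p = Q (2 * n - 4) (p - 1)
  middle_eq : Q (2 * n - 2) m' = Q (2 * n - 3) m'
  middle_mem : Q (2 * n - 2) m' ∈
    if m ≤ m' then Set.Icc (lam (m' + 1)) (Q (2 * n - 4) (m' - 1))
    else Set.Icc (lam m) (lam (m - 1))

/-- `Q` is the pattern `Q_{m'}^-` (with its own rows `1, …, 2n - 4`). -/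
def IsQMinus (n m m' : ℕ) (lam : ℕ → ℝ) (Q : ℕ → ℕ → ℝ) : Prop :=
  IsCornerType n m m' lam Q ∧ Q (2 * n - 2) m' = lam (m' + 1)

/-- `Q` is the pattern `Q_{m'}^+` (with its own rows `1, …, 2n - 4`). -/
def IsQPlus (n m m' : ℕ) (lam : ℕ → ℝ) (Q : ℕ → ℕ → ℝ) : Prop :=
  IsCornerType n m m' lam Q ∧
    Q (2 * n - 2) m' = if m ≤ m' then Q (2 * n - 4) (m' - 1) else lam (m - 1)

/-- `K_6(m') = {j ∈ [m-1, m'] ∪ [-n+1, -m'] | τ_{0,j} Q ∈ GT(lam)}`, where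
`τ_{0,j} = σ_{2n-2,j}`. -/
def K6 (n m m' : ℕ) (lam : ℕ → ℝ) (Q : ℕ → ℕ → ℝ) : Finset ℤ :=
  open scoped Classical in
  (Finset.Icc ((m : ℤ) - 1) m' ∪ Finset.Icc (-(n : ℤ) + 1) (-(m' : ℤ))).filter
    (fun j => IsGT n lam (shiftRow (2 * n - 2) j Q))

/-- The increasing list `j_3 < … < j_{N_1}` of `K_6(m') ∩ [m, m']`. -/
def jList (n m m' : ℕ) (lam : ℕ → ℝ) (Q : ℕ → ℕ → ℝ) : List ℤ :=
  (K6 n m m' lam Q ∩ Finset.Icc (m : ℤ) m').sort (· ≤ ·)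

/-- The increasing list `k_{N_1+1} < … < k_{N_2}` of `K_6(m') ∩ [-n+1, -m'-1]`. -/
def kList (n m m' : ℕ) (lam : ℕ → ℝ) (Q : ℕ → ℕ → ℝ) : List ℤ :=
  (K6 n m m' lam Q ∩ Finset.Icc (-(n : ℤ) + 1) (-(m' : ℤ) - 1)).sort (· ≤ ·)

/-- `N_1`. -/
def N1 (n m m' : ℕ) (lam : ℕ → ℝ) (Q : ℕ → ℕ → ℝ) : ℕ := (jList n m m' lam Q).length + 2

/-- `N_2`. -/
def N2 (n m m' : ℕ) (lam : ℕ → ℝ) (Q : ℕ → ℕ → ℝ) : ℕ :=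
  N1 n m m' lam Q + (kList n m m' lam Q).length

/-- The increasing numbering `j_3, …, j_{N_1}, k_{N_1+1}, …, k_{N_2}` of
`K_6(m') ∩ ([m, m'] ∪ [-n+1, -m'-1])`. -/
def increasingNumbering (n m m' : ℕ) (lam : ℕ → ℝ) (Q : ℕ → ℕ → ℝ) : List ℤ :=
  jList n m m' lam Q ++ kList n m m' lam Q

/-- The numbering `j_3, …, j_{N_1}, -m'-1, k, k', …` of the same set when it contains `-m'-1`:
that element is put first among the negative ones, the others keep their increasing order. -/
def frontNumbering (n m m' : ℕ) (lam : ℕ → ℝ) (Q : ℕ → ℕ → ℝ) : List ℤ :=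
  jList n m m' lam Q ++ (-(m' : ℤ) - 1) :: (kList n m m' lam Q).erase (-(m' : ℤ) - 1)

/-! ### The Mellin–Barnes integrals -/

/-- The parameters `N_2`, `α_1, …, α_{N_2}`, `β_3, …, β_{N_2}` of the Mellin–Barnes integrals. -/
structure Exponents where
  /-- The number of `α`'s. -/
  N : ℕ
  /-- The numbers `α_p`, `1 ≤ p ≤ N`. -/
  α : ℕ → ℝ
  /-- The numbers `β_p`, `3 ≤ p ≤ N`. -/
  β : ℕ → ℝ

/-- The exponents attached to `(m', Q)` when the elements of
`K_6(m') ∩ ([m, m'] ∪ [-n+1, -m'-1])` are numbered `3, 4, …` as in the list `idx`. -/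
def exponents (n m m' : ℕ) (ε : ℤˣ) (Λ : ℕ → ℝ) (Q : ℕ → ℕ → ℝ) (idx : List ℤ) : Exponents where
  N := idx.length + 2
  α p :=
    let x : ℝ := ((ε : ℤ) : ℝ) * Λ (n + 1)
    let y : ℝ := lEven (n - 1) Q ((m : ℤ) - 1) - 1
    ((ε : ℤ) : ℝ) * Λ n +
      if p = 1 then (if m ≤ m' then x else max x y)
      else if p = 2 then (if m ≤ m' then y else min x y)
      else lEven (n - 1) Q (idx.getD (p - 3) 0) - 1
  β p :=
    let j : ℤ := idx.getD (p - 3) 0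
    ((ε : ℤ) : ℝ) * Λ n + if 0 < j then lOdd (n - 1) Q (j - 1) else lOdd (n - 1) Q j

/-- The modified Bessel function `I_ν(z)` at `z = e^w`, with `(z/2)^ν = exp (ν (w - log 2))`.
(`Complex.Gamma` is `0` at its poles, so that `1 / Γ` has its usual value there.) -/
def besselI (ν w : ℂ) : ℂ :=
  Complex.exp (ν * (w - Real.log 2)) *
    ∑' k : ℕ, (Complex.exp w / 2) ^ (2 * k) / ((k.factorial : ℂ) * Complex.Gamma (ν + k + 1))

/-- The quotient `(π / 2) (I_{-ν}(z) - I_ν(z)) / sin (ν π)` at `z = e^w`. -/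
def besselKQuot (ν w : ℂ) : ℂ :=
  (Real.pi / 2 : ℂ) * ((besselI (-ν) w - besselI ν w) / Complex.sin (ν * Real.pi))

/-- The modified Bessel function `K_ν(z)` at `z = e^w`; for integral `ν` it is the limit of the
quotient that defines it for the other `ν`. -/
def besselK (ν w : ℂ) : ℂ :=
  open scoped Classical in
  if ∃ k : ℤ, ν = k then Filter.limUnder (nhdsWithin ν {ν}ᶜ) (fun μ => besselKQuot μ w)
  else besselKQuot ν w

/-- The superscript `L = K, I`. -/
inductive Kind
  | K
  | I

/-- The Gamma factor of the integrand of `f_j^L`. -/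
def Exponents.gammaFactor (D : Exponents) (j : ℕ) (s : ℂ) : ℂ :=
  if j = 1 then
    (∏ p ∈ Finset.Icc 1 D.N, Complex.Gamma (-(D.α p : ℂ) - s)) /
      ∏ p ∈ Finset.Icc 3 D.N, Complex.Gamma (1 - (D.β p : ℂ) - s)
  else
    ((∏ p ∈ Finset.Icc j D.N, Complex.Gamma (-(D.α p : ℂ) - s)) *
        ∏ p ∈ Finset.Icc 3 j, Complex.Gamma ((D.β p : ℂ) + s)) /
      ((∏ p ∈ Finset.Icc 1 (j - 1), Complex.Gamma (1 + (D.α p : ℂ) + s)) *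
        ∏ p ∈ Finset.Icc (j + 1) D.N, Complex.Gamma (1 - (D.β p : ℂ) - s))

/-- The integrand of `f_j^L(t_1, t_2)`, where `w₁`, `wp`, `wm` are the chosen logarithms of
`t_1`, `t_2`, `-t_2`. -/
def Exponents.integrand (D : Exponents) (L : Kind) (j : ℕ) (w₁ wp wm s : ℂ) : ℂ :=
  D.gammaFactor j s *
    match L with
    | Kind.K => Complex.exp (s * if j = 1 then wp else wm) * besselK (-s) w₁
    | Kind.I => Complex.exp (s * if j = 1 then wm else wp) * besselI (-s) w₁

/-- The integral of `F` along the loop `+∞ - ι → a - ι → a + ι → +∞ + ι`, which crosses the real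
axis at `a` and encircles `(a, +∞)` once in the negative direction. -/
def loopIntegral (a : ℝ) (F : ℂ → ℂ) : ℂ :=
  -(∫ u in Set.Ioi a, F ((u : ℂ) - Complex.I)) +
    (∫ v in (-1 : ℝ)..1, F ((a : ℂ) + (v : ℂ) * Complex.I) * Complex.I) +
    ∫ u in Set.Ioi a, F ((u : ℂ) + Complex.I)

/-- Absolute convergence of the integral along that loop. -/
def LoopIntegrable (a : ℝ) (F : ℂ → ℂ) : Prop :=
  MeasureTheory.IntegrableOn (fun u : ℝ => F ((u : ℂ) - Complex.I)) (Set.Ioi a) ∧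
  IntervalIntegrable (fun v : ℝ => F ((a : ℂ) + (v : ℂ) * Complex.I)) MeasureTheory.volume (-1) 1 ∧
  MeasureTheory.IntegrableOn (fun u : ℝ => F ((u : ℂ) + Complex.I)) (Set.Ioi a)

/-- The function `f_j^L`, as a function of the chosen logarithms `w₁`, `wp`, `wm` of `t_1`, `t_2`,
`-t_2`.  The loop crosses the real axis midway between `-α_j - 1` and `-α_j`; by Cauchy's theorem
any other loop of this kind gives the same value. -/
def Exponents.f (D : Exponents) (L : Kind) (j : ℕ) (w₁ wp wm : ℂ) : ℂ :=
  (1 / (2 * Real.pi * Complex.I)) * loopIntegral (-D.α j - 1 / 2) (D.integrand L j w₁ wp wm)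

/-! ### The shift operator -/

/-- The product `∏_{i < k} (∂_t + c_i)` of Euler operators, `∂_t = t d/dt`. -/
def eulerProduct (c : ℕ → ℂ) : ℕ → (ℂ → ℂ) → ℂ → ℂ
  | 0, g => g
  | k + 1, g => fun t => t * deriv (eulerProduct c k g) t + c k * eulerProduct c k g t

/-- The shift operator
`S_2(m') = ∏_{q = q_{2n-4,m'-1}}^{lam_{m'} - 1} (∂_{t_2} ± Λ_n - q - n + m')`, with unit steps
in `q`. -/
def shiftS2 (n m' : ℕ) (ε : ℤˣ) (Λ lam : ℕ → ℝ) (Q : ℕ → ℕ → ℝ) : (ℂ → ℂ) → ℂ → ℂ :=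
  eulerProduct
    (fun i => ((((ε : ℤ) : ℝ) * Λ n - (Q (2 * n - 4) (m' - 1) + i) - n + m' : ℝ) : ℂ))
    ⌊lam m' - Q (2 * n - 4) (m' - 1)⌋₊

/-- The integrals defining `f_j^L` (for `D`) and `f_{j'}^L` (for `D'`) converge absolutely, and
there is a constant `c ≠ 0` such that, for all local holomorphic branches `lp`, `lm` of `log t_2`,
`log (-t_2)` and all values `w₁` of `log t_1`, the function `f_j^L` is holomorphic in `t_2` and the
operator `S` in the variable `t_2` sends it to `c · f_{j'}^L`. -/
def ShiftsToNonzeroMultiple (S : (ℂ → ℂ) → ℂ → ℂ) (L : Kind)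
    (D : Exponents) (j : ℕ) (D' : Exponents) (j' : ℕ) : Prop :=
  (∀ w₁ wp wm : ℂ, LoopIntegrable (-D.α j - 1 / 2) (D.integrand L j w₁ wp wm) ∧
    LoopIntegrable (-D'.α j' - 1 / 2) (D'.integrand L j' w₁ wp wm)) ∧
  ∃ c : ℂ, c ≠ 0 ∧
    ∀ (U : Set ℂ) (lp lm : ℂ → ℂ), IsOpen U →
      DifferentiableOn ℂ lp U → DifferentiableOn ℂ lm U →
      (∀ t ∈ U, Complex.exp (lp t) = t ∧ Complex.exp (lm t) = -t) →
      ∀ w₁ : ℂ,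
        DifferentiableOn ℂ (fun t => D.f L j w₁ (lp t) (lm t)) U ∧
        ∀ t ∈ U, S (fun t' => D.f L j w₁ (lp t') (lm t')) t = c * D'.f L j' w₁ (lp t) (lm t)

end SpinWhittaker

end

noncomputable section

namespace SpinWhittaker

open Filter Topology MeasureTheory

/-! ### Points away from the integers -/

/-! The operator `∂_{t_2} + c` multiplies `t_2 ^ s` and `(-t_2) ^ s` by `s + c`, so `S_2(m')`
multiplies the integrand of `f_j` by a polynomial of degree `k = λ_{m'} - q_{2n-4,m'-1}`. Passing
from `Q_{m'}^+` to `Q_{m'-1}^-` keeps all exponents and adds the single index `-m'`. For its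
exponents `α`, `β` the functional equation of Gamma identifies the polynomial with `(-1) ^ k * Γ(-α
- s) / Γ(1 - β - s)`, which is exactly the factor that the new index contributes to the integrand of
`f_1` (`IsAdjacent.prod_shift_eq`).

For `j ≥ 2` the reflection formula reduces to this case: since all exponents are integers, the Gamma
factor of `f_j` is a constant times `sin (π s)` times that of `f_1` (`exists_gammaFactor_eq`). The
latter is symmetric in the places `p ≥ 3`, so a numbering matters only through `α_j`, which fixes
the contour. Both numberings therefore follow from one statement about permuted index lists
(`IsAdjacent.shiftsToNonzeroMultiple`), with `f_j` sent to the function whose place carries the same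
index.

Analytically, the whole loop stays at distance at least `1 / 2` from the integers. There the Gamma
and Bessel factors are continuous, and under `s ↦ s + 1` the integrand shrinks by a ratio tending to
zero, which beats every exponential in `s`. This gives absolute convergence for all values of the
logarithms and permits differentiation under the integral sign. -/

/-- The points whose distance to every integer is at least `1 / 2`. -/
def offIntegers : Set ℂ := {s | ∀ k : ℤ, 1 / 2 ≤ ‖s - k‖}

theorem offIntegers_ne {s : ℂ} (hs : s ∈ offIntegers) (k : ℤ) : s ≠ k := by
  rintro rfl
  have := hs k
  norm_num at this

theorem offIntegers_add_int {s : ℂ} (hs : s ∈ offIntegers) (k : ℤ) : s + k ∈ offIntegers := by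
  intro l
  have := hs (l - k)
  convert this using 2
  push_cast
  ring

theorem offIntegers_neg {s : ℂ} (hs : s ∈ offIntegers) : -s ∈ offIntegers := by
  intro l
  have e : -(-s - (l : ℂ)) = s - ((-l : ℤ) : ℂ) := by push_cast; ring
  rw [← norm_neg, e]
  exact hs _

theorem offIntegers_add_one {s : ℂ} (hs : s ∈ offIntegers) : s + 1 ∈ offIntegers := by
  simpa using offIntegers_add_int hs 1

theorem offIntegers_of_im {s : ℂ} (hs : 1 / 2 ≤ |s.im|) : s ∈ offIntegers := fun k => by
  refine hs.trans ?_
  simpa using Complex.abs_im_le_norm (s - k)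

theorem offIntegers_of_re {s : ℂ} {k : ℤ} (hs : s.re = k - 1 / 2) : s ∈ offIntegers := fun l => by
  refine le_trans ?_ (Complex.abs_re_le_norm (s - l))
  have h : (s - l).re = ((k - l : ℤ) : ℝ) - 1 / 2 := by
    simp only [Complex.sub_re, Complex.intCast_re, hs]
    push_cast
    ring
  rw [h]
  rcases le_or_gt (k - l) 0 with h0 | h0
  · have : ((k - l : ℤ) : ℝ) ≤ 0 := by exact_mod_cast h0
    rw [abs_of_nonpos] <;> linarith
  · have : (1 : ℝ) ≤ ((k - l : ℤ) : ℝ) := by exact_mod_cast h0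
    rw [abs_of_nonneg] <;> linarith

theorem sin_pi_ne_zero {s : ℂ} (hs : s ∈ offIntegers) : Complex.sin (Real.pi * s) ≠ 0 := by
  rw [Ne, Complex.sin_eq_zero_iff]
  rintro ⟨k, hk⟩
  refine offIntegers_ne hs k ?_
  rw [mul_comm] at hk
  exact mul_right_cancel₀ (by exact_mod_cast Real.pi_ne_zero) hk

theorem Gamma_ne_zero_of_offIntegers {s : ℂ} (hs : s ∈ offIntegers) : Complex.Gamma s ≠ 0 :=
  Complex.Gamma_ne_zero fun m => by simpa using offIntegers_ne hs (-m)

theorem continuousOn_Gamma_offIntegers : ContinuousOn Complex.Gamma offIntegers := fun s hs =>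
  (Complex.differentiableAt_Gamma s fun m => by
    simpa using offIntegers_ne hs (-m)).continuousAt.continuousWithinAt

theorem Gamma_add_natCast_eq (z : ℂ) (k : ℕ) (h : ∀ i < k, z + i ≠ 0) :
    Complex.Gamma (z + k) = (∏ i ∈ Finset.range k, (z + i)) * Complex.Gamma z := by
  induction k with
  | zero => simp
  | succ k ih =>
    rw [Finset.prod_range_succ, Nat.cast_succ, ← add_assoc, Complex.Gamma_add_one _ (h k (by simp)),
      ih fun i hi => h i (by omega)]
    ring

/-! ### Bessel functions of order away from the integers -/

/-- The normalized Bessel series `∑ x ^ k / (k! (ν + 1)_k)`. -/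
def besselSeries (x ν : ℂ) : ℂ :=
  ∑' k : ℕ, x ^ k / ((k.factorial : ℂ) * ∏ i ∈ Finset.range k, (ν + 1 + i))

/-- Every factor `ν + 1 + i` has norm at least `1 / 2`, so the product costs at most `2 ^ k`. The
bound does not depend on `ν`, which gives continuity and boundedness in the order at once. -/
theorem norm_besselSeries_term_le (x : ℂ) {ν : ℂ} (hν : ν ∈ offIntegers) (k : ℕ) :
    ‖x ^ k / ((k.factorial : ℂ) * ∏ i ∈ Finset.range k, (ν + 1 + i))‖ ≤
      (2 * ‖x‖) ^ k / k.factorial := by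
  have h1 : (1 / 2 : ℝ) ^ k ≤ ‖∏ i ∈ Finset.range k, (ν + 1 + i)‖ := by
    rw [norm_prod]
    calc (1 / 2 : ℝ) ^ k = ∏ i ∈ Finset.range k, (1 / 2 : ℝ) := by simp
      _ ≤ _ := Finset.prod_le_prod (fun _ _ => by norm_num) fun i _ => by
        have e : ν + 1 + (i : ℂ) = ν - ((-(1 + i) : ℤ) : ℂ) := by push_cast; ring
        rw [e]
        exact hν _
  have h2 : (0 : ℝ) < k.factorial := by exact_mod_cast k.factorial_pos
  rw [norm_div, norm_mul, norm_pow, Complex.norm_natCast]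
  calc ‖x‖ ^ k / (k.factorial * ‖∏ i ∈ Finset.range k, (ν + 1 + i)‖)
      ≤ ‖x‖ ^ k / (k.factorial * (1 / 2 : ℝ) ^ k) := by gcongr
    _ = _ := by
      rw [mul_pow, one_div, inv_pow]
      field_simp

theorem continuousOn_besselSeries (x : ℂ) : ContinuousOn (besselSeries x) offIntegers := by
  refine continuousOn_tsum (fun k => ?_) (Real.summable_pow_div_factorial (2 * ‖x‖))
    fun k ν hν => norm_besselSeries_term_le x hν k
  refine ContinuousOn.div (by fun_prop) (by fun_prop) fun ν hν => ?_
  refine mul_ne_zero (by exact_mod_cast k.factorial_ne_zero)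
    (Finset.prod_ne_zero_iff.2 fun i _ h => offIntegers_ne hν (-(1 + i)) ?_)
  push_cast
  linear_combination h

theorem exists_norm_besselSeries_le (x : ℂ) :
    ∃ C, ∀ ν ∈ offIntegers, ‖besselSeries x ν‖ ≤ C :=
  ⟨_, fun _ hν => tsum_of_norm_bounded (Real.summable_pow_div_factorial (2 * ‖x‖)).hasSum
    (norm_besselSeries_term_le x hν)⟩

/-- Separates the dependence on the order into an exponential, one reciprocal Gamma value governed
by its functional equation, and a factor bounded off the integers. -/
theorem besselI_eq_besselSeries {ν : ℂ} (hν : ν ∈ offIntegers) (w : ℂ) :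
    besselI ν w = Complex.exp (ν * (w - Real.log 2)) * (Complex.Gamma (1 + ν))⁻¹ *
      besselSeries ((Complex.exp w / 2) ^ 2) ν := by
  have h : ∀ k : ℕ, Complex.Gamma (ν + k + 1) =
      (∏ i ∈ Finset.range k, (ν + 1 + i)) * Complex.Gamma (1 + ν) := fun k => by
    rw [add_right_comm, add_comm 1 ν]
    refine Gamma_add_natCast_eq _ _ fun i _ h => offIntegers_ne hν (-(1 + i)) ?_
    push_cast
    linear_combination h
  simp only [besselI, besselSeries, mul_assoc, ← tsum_mul_left, h, pow_mul, div_eq_mul_inv,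
    mul_inv]
  congr 1
  ext k
  ring

theorem besselK_eq_of_offIntegers {ν : ℂ} (hν : ν ∈ offIntegers) (w : ℂ) :
    besselK ν w = besselKQuot ν w :=
  if_neg fun ⟨k, hk⟩ => offIntegers_ne hν k hk

/-! ### Decay along horizontal lines -/

/-- A bound on one compact unit interval propagates to the right by unit steps, each gaining a
factor `e⁻¹`. -/
theorem isBigO_exp_neg_of_ratio {ψ : ℝ → ℂ} {a : ℝ} (hc : ContinuousOn ψ (Set.Ici a))
    (hr : ∀ᶠ u in atTop, ‖ψ (u + 1)‖ ≤ Real.exp (-1) * ‖ψ u‖) :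
    ψ =O[atTop] fun u => Real.exp (-1 * u) := by
  obtain ⟨U₀, hU₀⟩ := eventually_atTop.1 hr
  set U := max U₀ a
  obtain ⟨M, hM⟩ := (isCompact_Icc (a := U) (b := U + 1)).exists_bound_of_continuousOn
    (hc.mono fun x hx => (le_max_right U₀ a).trans hx.1)
  have key : ∀ k : ℕ, ∀ u ∈ Set.Icc U (U + 1), ‖ψ (u + k)‖ ≤ Real.exp (-k) * M := by
    intro k u hu
    induction k with
    | zero => simpa using hM u hu
    | succ k ih =>
      have h1 : U₀ ≤ u + k :=
        (le_max_left U₀ a).trans (hu.1.trans (le_add_of_nonneg_right k.cast_nonneg))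
      calc ‖ψ (u + (k + 1 : ℕ))‖ = ‖ψ (u + k + 1)‖ := by push_cast; rw [add_assoc]
        _ ≤ Real.exp (-1) * ‖ψ (u + k)‖ := hU₀ _ h1
        _ ≤ Real.exp (-1) * (Real.exp (-k) * M) := by gcongr
        _ = _ := by
          rw [← mul_assoc, ← Real.exp_add]
          congr 2
          push_cast
          ring
  -- The number of steps from the base interval to `u` exceeds `u - U - 1`, whence the factor `exp
  -- (U + 1)`.
  refine Asymptotics.IsBigO.of_bound (Real.exp (U + 1) * M) ?_
  filter_upwards [eventually_ge_atTop U] with u hu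
  have hk := Nat.floor_le (sub_nonneg.2 hu)
  have hk' := Nat.lt_floor_add_one (u - U)
  have h := key ⌊u - U⌋₊ (u - ⌊u - U⌋₊) ⟨by linarith, by linarith⟩
  rw [sub_add_cancel] at h
  have hM0 : 0 ≤ M := (norm_nonneg _).trans (hM U ⟨le_rfl, by linarith⟩)
  rw [Real.norm_of_nonneg (Real.exp_pos _).le, mul_right_comm, ← Real.exp_add]
  refine h.trans (mul_le_mul_of_nonneg_right (Real.exp_le_exp.2 ?_) hM0)
  linarith

theorem tendsto_add_div_add_cobounded (c d : ℂ) :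
    Tendsto (fun s : ℂ => (s + c) / (s + d)) (Bornology.cobounded ℂ) (𝓝 1) := by
  have hd : Tendsto (fun s : ℂ => s + d) (Bornology.cobounded ℂ) (Bornology.cobounded ℂ) :=
    tendsto_add_const_cobounded d
  have h : Tendsto (fun s : ℂ => 1 + (c - d) * (s + d)⁻¹) (Bornology.cobounded ℂ) (𝓝 1) := by
    simpa using ((tendsto_inv₀_cobounded.comp hd).const_mul (c - d)).const_add 1
  refine h.congr' ?_
  filter_upwards [hd.eventually (Bornology.eventually_ne_cobounded 0)] with s hs
  field_simp
  ring

theorem tendsto_ofReal_add_cobounded (e : ℂ) :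
    Tendsto (fun u : ℝ => (u : ℂ) + e) atTop (Bornology.cobounded ℂ) := by
  rw [← tendsto_norm_atTop_iff_cobounded]
  refine tendsto_atTop_mono (f := fun u : ℝ => u + e.re) (fun u => ?_)
    (tendsto_atTop_add_const_right _ _ tendsto_id)
  simpa using Complex.re_le_norm ((u : ℂ) + e)

/-! ### Exponents that are integers -/

/-- All the exponents `α_p`, `β_p` are integers, and there are at least two of the `α_p`. -/
structure Exponents.IsIntegral (D : Exponents) : Prop where
  two_le : 2 ≤ D.N
  α_int : ∀ p ∈ Finset.Icc 1 D.N, ∃ k : ℤ, D.α p = k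
  β_int : ∀ p ∈ Finset.Icc 3 D.N, ∃ k : ℤ, D.β p = k

theorem offIntegers_neg_sub {a : ℝ} (ha : ∃ k : ℤ, a = k) {s : ℂ} (hs : s ∈ offIntegers) :
    -(a : ℂ) - s ∈ offIntegers := by
  obtain ⟨k, rfl⟩ := ha
  convert offIntegers_neg (offIntegers_add_int hs k) using 1
  push_cast
  ring

theorem offIntegers_one_sub_sub {a : ℝ} (ha : ∃ k : ℤ, a = k) {s : ℂ} (hs : s ∈ offIntegers) :
    1 - (a : ℂ) - s ∈ offIntegers := by
  obtain ⟨k, rfl⟩ := ha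
  convert offIntegers_neg (offIntegers_add_int hs (k - 1)) using 1
  push_cast
  ring

theorem gammaFactor_one (D : Exponents) (s : ℂ) :
    D.gammaFactor 1 s = (∏ p ∈ Finset.Icc 1 D.N, Complex.Gamma (-(D.α p : ℂ) - s)) /
      ∏ p ∈ Finset.Icc 3 D.N, Complex.Gamma (1 - (D.β p : ℂ) - s) := by
  simp [Exponents.gammaFactor]

theorem continuousOn_gammaFactor_one {D : Exponents} (hD : D.IsIntegral) :
    ContinuousOn (D.gammaFactor 1) offIntegers := by
  have h : D.gammaFactor 1 = fun s => (∏ p ∈ Finset.Icc 1 D.N, Complex.Gamma (-(D.α p : ℂ) - s)) /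
      ∏ p ∈ Finset.Icc 3 D.N, Complex.Gamma (1 - (D.β p : ℂ) - s) := funext (gammaFactor_one D)
  rw [h]
  refine ContinuousOn.div (continuousOn_finsetProd _ fun p hp => ?_)
    (continuousOn_finsetProd _ fun p hp => ?_) fun s hs => Finset.prod_ne_zero_iff.2 fun p hp =>
      Gamma_ne_zero_of_offIntegers (offIntegers_one_sub_sub (hD.β_int p hp) hs)
  · exact continuousOn_Gamma_offIntegers.comp (by fun_prop)
      fun s hs => offIntegers_neg_sub (hD.α_int p hp) hs
  · exact continuousOn_Gamma_offIntegers.comp (by fun_prop)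
      fun s hs => offIntegers_one_sub_sub (hD.β_int p hp) hs

/-- The reflection formula for the Gamma function at points that differ by an integer. -/
theorem exists_Gamma_mul_Gamma (k : ℤ) : ∃ σ : ℂ, σ ≠ 0 ∧ ∀ s : ℂ,
    Complex.Gamma (1 - k - s) * Complex.Gamma (k + s) =
      σ * (Real.pi / Complex.sin (Real.pi * s)) := by
  refine ⟨((k.negOnePow : ℤ) : ℂ), by exact_mod_cast k.negOnePow.ne_zero, fun s => ?_⟩
  have h := Complex.Gamma_mul_Gamma_one_sub (k + s)
  have hsin : Complex.sin (Real.pi * (k + s)) =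
      ((k.negOnePow : ℤ) : ℂ) * Complex.sin (Real.pi * s) := by
    rw [← Complex.sin_antiperiodic.add_int_mul_eq k]
    ring_nf
  rw [mul_comm, sub_sub, h, hsin]
  rcases Int.units_eq_one_or k.negOnePow with h' | h' <;> simp [h', div_neg]

/-- Reflecting the `j - 1` factors `Γ(1 + α_p + s)` of the denominator and the `j - 2` factors
`Γ(β_p + s)` of the numerator turns them into the factors of `f_1`. Each reflection yields one `sin
(π s)` up to a constant because the exponents are integers, and the surplus is a single sine. -/
theorem exists_gammaFactor_eq {D : Exponents} (hD : D.IsIntegral) {j : ℕ}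
    (hj : 2 ≤ j) (hjN : j ≤ D.N) : ∃ σ : ℂ, σ ≠ 0 ∧ ∀ s ∈ offIntegers,
      D.gammaFactor j s = σ * Complex.sin (Real.pi * s) * D.gammaFactor 1 s := by
  have hα : ∀ p, ∃ σ : ℂ, σ ≠ 0 ∧ (p ∈ Finset.Icc 1 D.N → ∀ s ∈ offIntegers,
      Complex.Gamma (1 + (D.α p : ℂ) + s) =
        σ / (Complex.sin (Real.pi * s) * Complex.Gamma (-(D.α p : ℂ) - s))) := by
    intro p
    by_cases hp : p ∈ Finset.Icc 1 D.N
    · obtain ⟨k, hk⟩ := hD.α_int p hp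
      -- The pair `Γ(-α - s)`, `Γ(1 + α + s)` is the reflection pair of the integer `1 + α`.
      obtain ⟨σ, hσ, h⟩ := exists_Gamma_mul_Gamma (1 + k)
      refine ⟨σ * Real.pi, mul_ne_zero hσ (by exact_mod_cast Real.pi_ne_zero), fun _ s hs => ?_⟩
      have h0 := Gamma_ne_zero_of_offIntegers (offIntegers_neg_sub (hD.α_int p hp) hs)
      have h1 := sin_pi_ne_zero hs
      have h2 := h s
      have e : (1 : ℂ) - ((1 + k : ℤ) : ℂ) - s = -(D.α p : ℂ) - s := by rw [hk]; push_cast; ring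
      have e' : ((1 + k : ℤ) : ℂ) + s = 1 + (D.α p : ℂ) + s := by rw [hk]; push_cast; ring
      rw [e, e'] at h2
      rw [eq_div_iff (mul_ne_zero h1 h0)]
      rw [← mul_div_assoc, eq_div_iff h1] at h2
      linear_combination h2
    · exact ⟨1, one_ne_zero, fun h => absurd h hp⟩
  have hβ : ∀ p, ∃ σ : ℂ, σ ≠ 0 ∧ (p ∈ Finset.Icc 3 D.N → ∀ s ∈ offIntegers,
      Complex.Gamma ((D.β p : ℂ) + s) =
        σ / (Complex.sin (Real.pi * s) * Complex.Gamma (1 - (D.β p : ℂ) - s))) := by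
    intro p
    by_cases hp : p ∈ Finset.Icc 3 D.N
    · obtain ⟨k, hk⟩ := hD.β_int p hp
      obtain ⟨σ, hσ, h⟩ := exists_Gamma_mul_Gamma k
      refine ⟨σ * Real.pi, mul_ne_zero hσ (by exact_mod_cast Real.pi_ne_zero), fun _ s hs => ?_⟩
      have h0 := Gamma_ne_zero_of_offIntegers (offIntegers_one_sub_sub (hD.β_int p hp) hs)
      have h1 := sin_pi_ne_zero hs
      have h2 := h s
      have e : ((k : ℤ) : ℂ) = (D.β p : ℂ) := by rw [hk]; push_cast; ring
      rw [e] at h2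
      rw [eq_div_iff (mul_ne_zero h1 h0)]
      rw [← mul_div_assoc, eq_div_iff h1] at h2
      linear_combination h2
    · exact ⟨1, one_ne_zero, fun h => absurd h hp⟩
  choose σ hσ0 hσ using hα
  choose τ hτ0 hτ using hβ
  refine ⟨(∏ p ∈ Finset.Icc 3 j, τ p) / ∏ p ∈ Finset.Icc 1 (j - 1), σ p,
    div_ne_zero (Finset.prod_ne_zero_iff.2 fun p _ => hτ0 p)
      (Finset.prod_ne_zero_iff.2 fun p _ => hσ0 p), fun s hs => ?_⟩
  have h1 := sin_pi_ne_zero hs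
  have splitα : ∏ p ∈ Finset.Icc 1 D.N, Complex.Gamma (-(D.α p : ℂ) - s) =
      (∏ p ∈ Finset.Icc 1 (j - 1), Complex.Gamma (-(D.α p : ℂ) - s)) *
        ∏ p ∈ Finset.Icc j D.N, Complex.Gamma (-(D.α p : ℂ) - s) := by
    rw [← Finset.prod_union]
    · congr 1; ext p; simp only [Finset.mem_union, Finset.mem_Icc]; omega
    · rw [Finset.disjoint_left]; intro p; simp only [Finset.mem_Icc]; omega
  have splitβ : ∏ p ∈ Finset.Icc 3 D.N, Complex.Gamma (1 - (D.β p : ℂ) - s) =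
      (∏ p ∈ Finset.Icc 3 j, Complex.Gamma (1 - (D.β p : ℂ) - s)) *
        ∏ p ∈ Finset.Icc (j + 1) D.N, Complex.Gamma (1 - (D.β p : ℂ) - s) := by
    rw [← Finset.prod_union]
    · congr 1; ext p; simp only [Finset.mem_union, Finset.mem_Icc]; omega
    · rw [Finset.disjoint_left]; intro p; simp only [Finset.mem_Icc]; omega
  have eα : ∏ p ∈ Finset.Icc 1 (j - 1), Complex.Gamma (1 + (D.α p : ℂ) + s) =
      (∏ p ∈ Finset.Icc 1 (j - 1), σ p) / (Complex.sin (Real.pi * s) ^ (j - 1) *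
        ∏ p ∈ Finset.Icc 1 (j - 1), Complex.Gamma (-(D.α p : ℂ) - s)) := by
    rw [Finset.prod_congr rfl fun p hp => hσ p (by simp at hp ⊢; omega) s hs, Finset.prod_div_distrib,
      Finset.prod_mul_distrib, Finset.prod_const, Nat.card_Icc, Nat.add_sub_cancel]
  have eβ : ∏ p ∈ Finset.Icc 3 j, Complex.Gamma ((D.β p : ℂ) + s) =
      (∏ p ∈ Finset.Icc 3 j, τ p) / (Complex.sin (Real.pi * s) ^ (j - 2) *
        ∏ p ∈ Finset.Icc 3 j, Complex.Gamma (1 - (D.β p : ℂ) - s)) := by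
    rw [Finset.prod_congr rfl fun p hp => hτ p (by simp at hp ⊢; omega) s hs, Finset.prod_div_distrib,
      Finset.prod_mul_distrib, Finset.prod_const, Nat.card_Icc, show j + 1 - 3 = j - 2 by omega]
  have n1 : ∏ p ∈ Finset.Icc 1 (j - 1), Complex.Gamma (-(D.α p : ℂ) - s) ≠ 0 :=
    Finset.prod_ne_zero_iff.2 fun p hp => Gamma_ne_zero_of_offIntegers
      (offIntegers_neg_sub (hD.α_int p (by simp at hp ⊢; omega)) hs)
  have n2 : ∏ p ∈ Finset.Icc 1 (j - 1), σ p ≠ 0 := Finset.prod_ne_zero_iff.2 fun p _ => hσ0 p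
  rw [gammaFactor_one, Exponents.gammaFactor, if_neg (by omega), splitα, splitβ, eα, eβ,
    show Complex.sin (Real.pi * s) ^ (j - 1) = Complex.sin (Real.pi * s) ^ (j - 2) *
      Complex.sin (Real.pi * s) by rw [← pow_succ]; congr 1; omega]
  generalize Complex.sin (Real.pi * s) = S at h1 ⊢
  simp only [div_eq_mul_inv, mul_inv, inv_inv]
  field_simp

/-! ### Decay of the Gamma factor -/

theorem norm_gammaFactor_one_add_one {D : Exponents} (hD : D.IsIntegral) {s : ℂ}
    (hs : s ∈ offIntegers) :
    ‖D.gammaFactor 1 (s + 1)‖ = (∏ p ∈ Finset.Icc 3 D.N, ‖s + D.β p‖) /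
      (∏ p ∈ Finset.Icc 1 D.N, ‖s + (D.α p + 1)‖) * ‖D.gammaFactor 1 s‖ := by
  have hα : ∀ p ∈ Finset.Icc 1 D.N, ‖Complex.Gamma (-(D.α p : ℂ) - (s + 1))‖ =
      ‖Complex.Gamma (-(D.α p : ℂ) - s)‖ / ‖s + (D.α p + 1)‖ := by
    intro p hp
    have h := offIntegers_ne (offIntegers_neg_sub (hD.α_int p hp) (offIntegers_add_one hs)) 0
    rw [Int.cast_zero] at h
    have h' := Complex.Gamma_add_one _ h
    rw [show -(D.α p : ℂ) - (s + 1) + 1 = -(D.α p : ℂ) - s by ring] at h'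
    have e : ‖-(D.α p : ℂ) - (s + 1)‖ = ‖s + (D.α p + 1)‖ := by
      rw [← norm_neg]; congr 1; ring
    rw [h', norm_mul, e, mul_div_cancel_left₀]
    rwa [← e, norm_ne_zero_iff]
  have hβ : ∀ p ∈ Finset.Icc 3 D.N, ‖Complex.Gamma (1 - (D.β p : ℂ) - (s + 1))‖ =
      ‖Complex.Gamma (1 - (D.β p : ℂ) - s)‖ / ‖s + D.β p‖ := by
    intro p hp
    have h := offIntegers_ne (offIntegers_neg_sub (hD.β_int p hp) hs) 0
    rw [Int.cast_zero] at h
    have h' := Complex.Gamma_add_one _ h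
    rw [show -(D.β p : ℂ) - s + 1 = 1 - (D.β p : ℂ) - s by ring] at h'
    have e : ‖-(D.β p : ℂ) - s‖ = ‖s + D.β p‖ := by
      rw [← norm_neg]; congr 1; ring
    rw [h', norm_mul, e, mul_div_cancel_left₀, show 1 - (D.β p : ℂ) - (s + 1) = -(D.β p : ℂ) - s by ring]
    rwa [← e, norm_ne_zero_iff]
  simp only [gammaFactor_one, norm_div, norm_prod]
  rw [Finset.prod_congr rfl hα, Finset.prod_congr rfl hβ, Finset.prod_div_distrib,
    Finset.prod_div_distrib]
  simp only [div_eq_mul_inv, mul_inv, inv_inv]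
  ring

/-- The denominator has two more factors than the numerator. The places `p ≥ 3` pair into quotients
tending to `1`, place `1` absorbs the extra `‖s‖`, and place `2` forces the limit zero. The spare
`‖s‖` pays for the growth of the reciprocal Gamma value in `I_{-s}`. -/
theorem tendsto_ratio_cobounded {D : Exponents} (hD : D.IsIntegral) :
    Tendsto (fun s : ℂ => ‖s‖ * ((∏ p ∈ Finset.Icc 3 D.N, ‖s + D.β p‖) /
      (∏ p ∈ Finset.Icc 1 D.N, ‖s + (D.α p + 1)‖))) (Bornology.cobounded ℂ) (𝓝 0) := by
  have h1 := (tendsto_add_div_add_cobounded 0 (D.α 1 + 1)).norm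
  have h2 := (tendsto_inv₀_cobounded.comp (tendsto_add_const_cobounded (D.α 2 + 1 : ℂ))).norm
  have h3 := tendsto_finsetProd (Finset.Icc 3 D.N) fun p _ =>
    (tendsto_add_div_add_cobounded (D.β p) (D.α p + 1)).norm
  have h := (h1.mul h2).mul h3
  simp only [norm_zero, mul_zero, zero_mul] at h
  refine h.congr fun s => ?_
  have e : Finset.Icc 1 D.N = insert 1 (insert 2 (Finset.Icc 3 D.N)) := by
    have := hD.two_le
    ext p; simp only [Finset.mem_insert, Finset.mem_Icc]; omega
  rw [e, Finset.prod_insert (by simp), Finset.prod_insert (by simp)]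
  simp only [norm_div, norm_inv, Function.comp, add_zero, Finset.prod_div_distrib]
  simp only [div_eq_mul_inv, mul_inv]
  ring

/-- A continuous multiplier `P` with `P (s + 1) = O(s P s)` leaves the Gamma factor integrable along
horizontal lines, against any exponential and any bounded factor. -/
theorem integrableOn_gammaFactor_mul {D : Exponents} (hD : D.IsIntegral) {P b : ℂ → ℂ}
    (hP : ContinuousOn P offIntegers)
    (hP1 : ∀ s ∈ offIntegers, ‖P (s + 1)‖ ≤ 4 * ‖s‖ * ‖P s‖)
    (hb : ContinuousOn b offIntegers) {C : ℝ} (hC : ∀ s ∈ offIntegers, ‖b s‖ ≤ C)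
    (w e : ℂ) (he : ∀ u : ℝ, (u : ℂ) + e ∈ offIntegers) (a : ℝ) :
    IntegrableOn (fun u : ℝ => D.gammaFactor 1 (u + e) * P (u + e) * Complex.exp ((u + e) * w) *
      b (u + e)) (Set.Ioi a) := by
  have hline : Continuous fun u : ℝ => (u : ℂ) + e := by fun_prop
  have hcomp : ∀ {F : ℂ → ℂ}, ContinuousOn F offIntegers → Continuous fun u : ℝ => F (u + e) :=
    fun hF => hF.comp_continuous hline he
  set ψ : ℝ → ℂ := fun u => D.gammaFactor 1 (u + e) * P (u + e) * Complex.exp ((u + e) * w) with hψ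
  have hψc : Continuous ψ :=
    ((hcomp (continuousOn_gammaFactor_one hD)).mul (hcomp hP)).mul (by fun_prop)
  have hratio : ∀ᶠ u in atTop, ‖ψ (u + 1)‖ ≤ Real.exp (-1) * ‖ψ u‖ := by
    -- The factor `4` comes from `hP1`, and `exp w.re` from one step of the exponential.
    have h := ((tendsto_ratio_cobounded hD).comp (tendsto_ofReal_add_cobounded e)).const_mul
      (4 * Real.exp w.re)
    rw [mul_zero] at h
    filter_upwards [h.eventually_le_const (Real.exp_pos (-1))] with u hu
    have hs := he u
    set s : ℂ := (u : ℂ) + e with hs_def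
    have e1 : ((u + 1 : ℝ) : ℂ) + e = s + 1 := by rw [hs_def]; push_cast; ring
    have e2 : ‖Complex.exp ((s + 1) * w)‖ = Real.exp w.re * ‖Complex.exp (s * w)‖ := by
      rw [add_mul, one_mul, Complex.exp_add, norm_mul, Complex.norm_exp w, mul_comm]
    simp only [Function.comp] at hu
    simp only [hψ, e1, norm_mul, e2]
    rw [norm_gammaFactor_one_add_one hD hs]
    have := hP1 s hs
    set R := (∏ p ∈ Finset.Icc 3 D.N, ‖s + D.β p‖) /
      (∏ p ∈ Finset.Icc 1 D.N, ‖s + (D.α p + 1)‖)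
    have hR : 0 ≤ R := by positivity
    calc R * ‖D.gammaFactor 1 s‖ * ‖P (s + 1)‖ * (Real.exp w.re * ‖Complex.exp (s * w)‖)
        ≤ R * ‖D.gammaFactor 1 s‖ * (4 * ‖s‖ * ‖P s‖) * (Real.exp w.re * ‖Complex.exp (s * w)‖) := by
          gcongr
      _ = 4 * Real.exp w.re * (‖s‖ * R) * (‖D.gammaFactor 1 s‖ * ‖P s‖ * ‖Complex.exp (s * w)‖) := by
          ring
      _ ≤ _ := by gcongr
  have hint : IntegrableOn ψ (Set.Ioi a) := by
    rw [IntegrableOn, ← integrable_norm_iff hψc.aestronglyMeasurable]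
    exact integrable_of_isBigO_exp_neg one_pos hψc.norm.continuousOn
      (isBigO_exp_neg_of_ratio (a := a) hψc.continuousOn hratio).norm_left
  exact Integrable.mul_bdd (c := C) hint (hcomp hb).aestronglyMeasurable
    (Eventually.of_forall fun u => hC _ (he u))

/-! ### Differentiation of loop integrals -/

/-- Since the imaginary part of `γ` is bounded, `exp (2 ‖γ‖)` is at most a constant times `exp (2 Re
γ) + exp (-2 Re γ)`. The derivatives for `w` near `w₀` are thus dominated by the integrand at `w₀ +
2` and `w₀ - 2`, so integrability for all `w` is the only input. -/
theorem hasDerivAt_integral_mul_exp {μ : Measure ℝ} {γ h : ℝ → ℂ} (hγ : AEStronglyMeasurable γ μ)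
    (him : ∀ᵐ u ∂μ, |(γ u).im| ≤ 1)
    (hint : ∀ w : ℂ, Integrable (fun u => h u * Complex.exp (γ u * w)) μ) (w₀ : ℂ) :
    Integrable (fun u => γ u * h u * Complex.exp (γ u * w₀)) μ ∧
      HasDerivAt (fun w => ∫ u, h u * Complex.exp (γ u * w) ∂μ)
        (∫ u, γ u * h u * Complex.exp (γ u * w₀) ∂μ) w₀ := by
  refine hasDerivAt_integral_of_dominated_loc_of_deriv_le (𝕜 := ℂ)
    (bound := fun u => Real.exp 2 * (‖h u * Complex.exp (γ u * (w₀ + 2))‖ +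
      ‖h u * Complex.exp (γ u * (w₀ - 2))‖))
    (F' := fun w u => γ u * h u * Complex.exp (γ u * w))
    (Metric.ball_mem_nhds w₀ one_pos) (Eventually.of_forall fun w => (hint w).1) (hint w₀) ?_ ?_
    (((hint _).norm.add (hint _).norm).const_mul _) (Eventually.of_forall fun u w _ => ?_)
  · simp only [mul_assoc]
    exact hγ.mul (hint w₀).1
  · filter_upwards [him] with u hu w hw
    have hw' : ‖w - w₀‖ ≤ 1 := by
      rw [Metric.mem_ball, dist_eq_norm] at hw
      exact hw.le
    have e1 : Complex.exp (γ u * w) = Complex.exp (γ u * w₀) * Complex.exp (γ u * (w - w₀)) := by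
      rw [← Complex.exp_add]
      ring_nf
    have e2 : ‖Complex.exp (γ u * (w - w₀))‖ ≤ Real.exp ‖γ u‖ := by
      rw [Complex.norm_exp]
      refine Real.exp_le_exp.2 ((Complex.re_le_norm _).trans ?_)
      rw [norm_mul]
      exact mul_le_of_le_one_right (norm_nonneg _) hw'
    -- The linear factor brought down by differentiation is traded for a second exponential.
    have e3 : ‖γ u‖ ≤ Real.exp ‖γ u‖ := by linarith [Real.add_one_le_exp ‖γ u‖]
    have e4 : ‖γ u‖ ≤ |(γ u).re| + 1 := (Complex.norm_le_abs_re_add_abs_im _).trans (by linarith)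
    have e5 : ∀ c : ℝ, ‖h u * Complex.exp (γ u * (w₀ + c))‖ =
        ‖h u * Complex.exp (γ u * w₀)‖ * Real.exp (c * (γ u).re) := by
      intro c
      rw [mul_add, Complex.exp_add, ← mul_assoc, norm_mul, Complex.norm_exp (γ u * c)]
      simp [mul_comm]
    have e6 := e5 2
    have e7 := e5 (-2)
    push_cast at e6 e7
    rw [← sub_eq_add_neg] at e7
    rw [e6, e7, ← mul_add]
    have e8 : Real.exp ‖γ u‖ * Real.exp ‖γ u‖ ≤
        Real.exp 2 * (Real.exp (2 * (γ u).re) + Real.exp (-2 * (γ u).re)) := by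
      rw [← Real.exp_add, mul_add, ← Real.exp_add, ← Real.exp_add]
      rcases abs_cases (γ u).re with ⟨h1, _⟩ | ⟨h1, _⟩
      · have : Real.exp (‖γ u‖ + ‖γ u‖) ≤ Real.exp (2 + 2 * (γ u).re) :=
          Real.exp_le_exp.2 (by linarith)
        linarith [Real.exp_pos (2 + -2 * (γ u).re)]
      · have : Real.exp (‖γ u‖ + ‖γ u‖) ≤ Real.exp (2 + -2 * (γ u).re) :=
          Real.exp_le_exp.2 (by linarith)
        linarith [Real.exp_pos (2 + 2 * (γ u).re)]
    calc ‖γ u * h u * Complex.exp (γ u * w)‖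
        = ‖h u * Complex.exp (γ u * w₀)‖ * (‖γ u‖ * ‖Complex.exp (γ u * (w - w₀))‖) := by
          rw [e1]; simp only [norm_mul]; ring
      _ ≤ ‖h u * Complex.exp (γ u * w₀)‖ * (Real.exp ‖γ u‖ * Real.exp ‖γ u‖) := by gcongr
      _ ≤ ‖h u * Complex.exp (γ u * w₀)‖ *
          (Real.exp 2 * (Real.exp (2 * (γ u).re) + Real.exp (-2 * (γ u).re))) := by gcongr
      _ = _ := by ring
  · have := (((hasDerivAt_id w).const_mul (γ u)).cexp).const_mul (h u)
    refine this.congr_deriv ?_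
    simp only [id]
    ring

theorem loopIntegrable_iff {a : ℝ} {F : ℂ → ℂ} : LoopIntegrable a F ↔
    Integrable (fun u : ℝ => F ((u : ℂ) - Complex.I)) (volume.restrict (Set.Ioi a)) ∧
    Integrable (fun v : ℝ => F ((a : ℂ) + (v : ℂ) * Complex.I))
      (volume.restrict (Set.Ioc (-1) 1)) ∧
    Integrable (fun u : ℝ => F ((u : ℂ) + Complex.I)) (volume.restrict (Set.Ioi a)) := by
  rw [LoopIntegrable, intervalIntegrable_iff_integrableOn_Ioc_of_le (by norm_num)]
  rfl

theorem loopIntegral_eq (a : ℝ) (F : ℂ → ℂ) : loopIntegral a F =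
    -(∫ u in Set.Ioi a, F ((u : ℂ) - Complex.I)) +
      (∫ v in Set.Ioc (-1 : ℝ) 1, F ((a : ℂ) + (v : ℂ) * Complex.I)) * Complex.I +
      ∫ u in Set.Ioi a, F ((u : ℂ) + Complex.I) := by
  rw [loopIntegral, intervalIntegral.integral_mul_const,
    intervalIntegral.integral_of_le (by norm_num)]

theorem loopIntegral_congr {a : ℝ} {F G : ℂ → ℂ}
    (h : ∀ s : ℂ, |s.im| = 1 ∨ s.re = a → F s = G s) : loopIntegral a F = loopIntegral a G := by
  have h1 : ∀ u : ℝ, F ((u : ℂ) - Complex.I) = G ((u : ℂ) - Complex.I) :=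
    fun u => h _ (Or.inl (by simp))
  have h2 : ∀ v : ℝ, F ((a : ℂ) + (v : ℂ) * Complex.I) = G ((a : ℂ) + (v : ℂ) * Complex.I) :=
    fun v => h _ (Or.inr (by simp))
  have h3 : ∀ u : ℝ, F ((u : ℂ) + Complex.I) = G ((u : ℂ) + Complex.I) :=
    fun u => h _ (Or.inl (by simp))
  simp only [loopIntegral, h1, h2, h3]

theorem LoopIntegrable.add {a : ℝ} {F G : ℂ → ℂ} (hF : LoopIntegrable a F)
    (hG : LoopIntegrable a G) : LoopIntegrable a (fun s => F s + G s) :=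
  ⟨hF.1.add hG.1, hF.2.1.add hG.2.1, hF.2.2.add hG.2.2⟩

theorem LoopIntegrable.const_mul {a : ℝ} {F : ℂ → ℂ} (hF : LoopIntegrable a F) (c : ℂ) :
    LoopIntegrable a (fun s => c * F s) :=
  ⟨Integrable.const_mul hF.1 c, hF.2.1.const_mul c, Integrable.const_mul hF.2.2 c⟩

theorem loopIntegral_add {a : ℝ} {F G : ℂ → ℂ} (hF : LoopIntegrable a F)
    (hG : LoopIntegrable a G) :
    loopIntegral a (fun s => F s + G s) = loopIntegral a F + loopIntegral a G := by
  rw [loopIntegrable_iff] at hF hG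
  simp only [loopIntegral_eq]
  rw [integral_add hF.1 hG.1, integral_add hF.2.1 hG.2.1, integral_add hF.2.2 hG.2.2]
  ring

theorem loopIntegral_const_mul (a : ℝ) (c : ℂ) (F : ℂ → ℂ) :
    loopIntegral a (fun s => c * F s) = c * loopIntegral a F := by
  simp only [loopIntegral_eq, integral_const_mul]
  ring

theorem hasDerivAt_loopIntegral {a : ℝ} {h : ℂ → ℂ}
    (hint : ∀ w : ℂ, LoopIntegrable a (fun s => h s * Complex.exp (s * w))) (w : ℂ) :
    LoopIntegrable a (fun s => s * h s * Complex.exp (s * w)) ∧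
      HasDerivAt (fun w => loopIntegral a (fun s => h s * Complex.exp (s * w)))
        (loopIntegral a (fun s => s * h s * Complex.exp (s * w))) w := by
  simp only [loopIntegrable_iff] at hint ⊢
  have h1 := hasDerivAt_integral_mul_exp (μ := volume.restrict (Set.Ioi a))
    (γ := fun u => (u : ℂ) - Complex.I) (h := fun u => h ((u : ℂ) - Complex.I))
    (Continuous.aestronglyMeasurable (by fun_prop)) (Eventually.of_forall fun u => by simp)
    (fun w => (hint w).1) w
  have h2 := hasDerivAt_integral_mul_exp (μ := volume.restrict (Set.Ioc (-1) 1))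
    (γ := fun v => (a : ℂ) + (v : ℂ) * Complex.I)
    (h := fun v => h ((a : ℂ) + (v : ℂ) * Complex.I))
    (Continuous.aestronglyMeasurable (by fun_prop))
    ((ae_restrict_iff' measurableSet_Ioc).2 <| Eventually.of_forall fun v hv => by
      simpa [abs_le] using ⟨hv.1.le, hv.2⟩)
    (fun w => (hint w).2.1) w
  have h3 := hasDerivAt_integral_mul_exp (μ := volume.restrict (Set.Ioi a))
    (γ := fun u => (u : ℂ) + Complex.I) (h := fun u => h ((u : ℂ) + Complex.I))
    (Continuous.aestronglyMeasurable (by fun_prop)) (Eventually.of_forall fun u => by simp)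
    (fun w => (hint w).2.2) w
  refine ⟨⟨h1.1, h2.1, h3.1⟩, ?_⟩
  simp only [loopIntegral_eq]
  exact (h1.2.neg.add (h2.2.mul_const _)).add h3.2

/-- Euler operators in `t`, applied to `∫ h(s) t ^ s ds`, act on the integrand as polynomials
in `s`. -/
theorem eulerProduct_loopIntegral {a : ℝ} {h : ℂ → ℂ}
    (hint : ∀ w : ℂ, LoopIntegrable a (fun s => h s * Complex.exp (s * w)))
    {U : Set ℂ} (hU : IsOpen U) {l : ℂ → ℂ} (hl : DifferentiableOn ℂ l U)
    (hl' : ∀ t ∈ U, t * deriv l t = 1) (κ : ℂ) (c : ℕ → ℂ) (k : ℕ) :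
    (∀ w : ℂ, LoopIntegrable a
      (fun s => (∏ i ∈ Finset.range k, (s + c i)) * h s * Complex.exp (s * w))) ∧
    ∀ t ∈ U, eulerProduct c k
        (fun t => κ * loopIntegral a (fun s => h s * Complex.exp (s * l t))) t =
      κ * loopIntegral a
        (fun s => (∏ i ∈ Finset.range k, (s + c i)) * h s * Complex.exp (s * l t)) := by
  induction k with
  | zero => simpa [eulerProduct] using hint
  | succ k ih =>
    obtain ⟨ih1, ih2⟩ := ih
    have hd := hasDerivAt_loopIntegral ih1
    have e : ∀ w : ℂ, (fun s => (∏ i ∈ Finset.range (k + 1), (s + c i)) * h s *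
        Complex.exp (s * w)) = fun s =>
        s * ((∏ i ∈ Finset.range k, (s + c i)) * h s) * Complex.exp (s * w) +
        c k * ((∏ i ∈ Finset.range k, (s + c i)) * h s * Complex.exp (s * w)) := fun w => by
      ext s
      rw [Finset.prod_range_succ]
      ring
    refine ⟨fun w => ?_, fun t ht => ?_⟩
    · rw [e]
      exact (hd w).1.add ((ih1 w).const_mul _)
    · rw [e, loopIntegral_add (hd _).1 ((ih1 _).const_mul _), loopIntegral_const_mul, eulerProduct]
      beta_reduce
      rw [ih2 t ht]
      have hlt := (hl.differentiableAt (hU.mem_nhds ht)).hasDerivAt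
      -- The induction hypothesis is an identity on `U` only; openness of `U` makes it usable under
      -- `deriv`.
      have h1 := (((hd (l t)).2.comp t hlt).const_mul κ).congr_of_eventuallyEq
        (f₁ := eulerProduct c k
          (fun t => κ * loopIntegral a (fun s => h s * Complex.exp (s * l t))))
        (by filter_upwards [hU.mem_nhds ht] with t' ht' using ih2 t' ht')
      rw [h1.deriv]
      linear_combination κ * loopIntegral a
        (fun s => s * ((∏ i ∈ Finset.range k, (s + c i)) * h s) * Complex.exp (s * l t)) * hl' t ht

/-- The constant `κ` is `1` for branches of `log t` and `-1` for branches of `log (-t)`: the Euler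
operator does not distinguish them. -/
theorem mul_deriv_log_branch {U : Set ℂ} (hU : IsOpen U) {l : ℂ → ℂ} (hl : DifferentiableOn ℂ l U)
    {κ : ℂ} (hκ : κ ≠ 0) (h : ∀ t ∈ U, Complex.exp (l t) = κ * t) {t : ℂ} (ht : t ∈ U) :
    t * deriv l t = 1 := by
  have h1 := (hl.differentiableAt (hU.mem_nhds ht)).hasDerivAt.cexp
  have h2 : HasDerivAt (fun t => Complex.exp (l t)) (κ * 1) t :=
    ((hasDerivAt_id t).const_mul κ).congr_of_eventuallyEq
      (by filter_upwards [hU.mem_nhds ht] with t' ht' using h t' ht')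
  have h3 := h1.unique h2
  rw [h t ht, mul_assoc] at h3
  exact mul_left_cancel₀ hκ h3

/-! ### Convergence of the Mellin–Barnes integrals -/

/-- The Bessel factor of the integrand. -/
def besselKernel : Kind → ℂ → ℂ → ℂ
  | Kind.K, w₁, s => besselK (-s) w₁
  | Kind.I, w₁, s => besselI (-s) w₁

/-- The logarithm that enters the integrand of `f_j^L`. -/
def branchOf {X : Type*} : Kind → ℕ → X → X → X
  | Kind.K, j, xp, xm => if j = 1 then xp else xm
  | Kind.I, j, xp, xm => if j = 1 then xm else xp

theorem integrand_eq (D : Exponents) (L : Kind) (j : ℕ) (w₁ wp wm s : ℂ) :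
    D.integrand L j w₁ wp wm s =
      D.gammaFactor j s * besselKernel L w₁ s * Complex.exp (s * branchOf L j wp wm) := by
  cases L <;> simp only [Exponents.integrand, besselKernel, branchOf] <;> ring

/-- Factors by which the `f_j` differ, whose absolute value is invariant under `s ↦ s + 1`. -/
structure IsNormPeriodic (T : ℂ → ℂ) : Prop where
  continuousOn : ContinuousOn T offIntegers
  norm_add_one : ∀ s ∈ offIntegers, ‖T (s + 1)‖ = ‖T s‖

theorem isNormPeriodic_const (c : ℂ) : IsNormPeriodic fun _ => c :=
  ⟨continuousOn_const, fun _ _ => rfl⟩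

theorem isNormPeriodic_sin : IsNormPeriodic fun s => Complex.sin (Real.pi * s) :=
  ⟨by fun_prop, fun s _ => by rw [mul_add, mul_one, Complex.sin_add_pi, norm_neg]⟩

theorem IsNormPeriodic.mul {T T' : ℂ → ℂ} (h : IsNormPeriodic T) (h' : IsNormPeriodic T') :
    IsNormPeriodic fun s => T s * T' s :=
  ⟨h.1.mul h'.1, fun s hs => by rw [norm_mul, norm_mul, h.2 s hs, h'.2 s hs]⟩

theorem isNormPeriodic_inv_sin : IsNormPeriodic fun s => (Complex.sin (Real.pi * s))⁻¹ :=
  ⟨isNormPeriodic_sin.1.inv₀ fun _ hs => sin_pi_ne_zero hs,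
    fun s hs => by rw [norm_inv, norm_inv, isNormPeriodic_sin.2 s hs]⟩

theorem exists_gammaFactor_eq_mul {D : Exponents} (hD : D.IsIntegral) {j : ℕ}
    (hj : 1 ≤ j) (hjN : j ≤ D.N) : ∃ T : ℂ → ℂ, IsNormPeriodic T ∧
      ∀ s ∈ offIntegers, D.gammaFactor j s = T s * D.gammaFactor 1 s := by
  rcases hj.eq_or_lt with rfl | hj
  · exact ⟨_, isNormPeriodic_const 1, fun s _ => (one_mul _).symm⟩
  · obtain ⟨σ, -, h⟩ := exists_gammaFactor_eq hD hj hjN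
    exact ⟨_, (isNormPeriodic_const σ).mul isNormPeriodic_sin, h⟩

theorem continuousOn_gammaFactor {D : Exponents} (hD : D.IsIntegral) {j : ℕ}
    (hj : 1 ≤ j) (hjN : j ≤ D.N) : ContinuousOn (D.gammaFactor j) offIntegers := by
  obtain ⟨T, hT, h⟩ := exists_gammaFactor_eq_mul hD hj hjN
  exact (hT.1.mul (continuousOn_gammaFactor_one hD)).congr h

theorem continuousOn_besselI (w : ℂ) : ContinuousOn (fun ν => besselI ν w) offIntegers := by
  refine ContinuousOn.congr ?_ fun ν hν => besselI_eq_besselSeries hν w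
  have h : Continuous fun ν : ℂ => (Complex.Gamma (1 + ν))⁻¹ :=
    Complex.differentiable_one_div_Gamma.continuous.comp (by fun_prop : Continuous fun ν : ℂ => 1 + ν)
  exact (ContinuousOn.mul (by fun_prop) h.continuousOn).mul (continuousOn_besselSeries _)

/-- The coefficients of `I_{-s}` and `I_s` have absolute value invariant under `s ↦ s + 1`, so
convergence for `K` reduces to convergence for these two. -/
theorem besselK_neg_eq {s : ℂ} (hs : s ∈ offIntegers) (w : ℂ) :
    besselK (-s) w = (Real.pi / 2 : ℂ) *
      ((Complex.sin (Real.pi * s))⁻¹ * besselI (-s) w +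
        -(Complex.sin (Real.pi * s))⁻¹ * besselI s w) := by
  rw [besselK_eq_of_offIntegers (offIntegers_neg hs), besselKQuot, neg_neg, neg_mul,
    Complex.sin_neg, mul_comm s, div_neg, div_eq_mul_inv]
  ring

theorem continuousOn_besselKernel (L : Kind) (w : ℂ) :
    ContinuousOn (besselKernel L w) offIntegers := by
  have h1 : ContinuousOn (fun s => besselI (-s) w) offIntegers :=
    (continuousOn_besselI w).comp (by fun_prop) fun s hs => offIntegers_neg hs
  have h2 := isNormPeriodic_inv_sin.1
  cases L
  · exact (continuousOn_const.mul ((h2.mul h1).add (h2.neg.mul (continuousOn_besselI w)))).congr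
      fun s hs => besselK_neg_eq hs w
  · exact h1

/-- From `Γ(1 - s) = -s Γ(-s)`, the reciprocal Gamma value in `I_{-s}` grows by exactly `‖s‖` at
each step, within the allowance of `integrableOn_gammaFactor_mul`. -/
theorem integrableOn_mul_besselI_neg {D : Exponents} (hD : D.IsIntegral) {T : ℂ → ℂ}
    (hT : IsNormPeriodic T) (w₁ w e : ℂ) (he : ∀ u : ℝ, (u : ℂ) + e ∈ offIntegers) (a : ℝ) :
    IntegrableOn (fun u : ℝ => T (u + e) * D.gammaFactor 1 (u + e) * besselI (-(u + e)) w₁ *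
      Complex.exp ((u + e) * w)) (Set.Ioi a) := by
  obtain ⟨C, hC⟩ := exists_norm_besselSeries_le ((Complex.exp w₁ / 2) ^ 2)
  have hΓ : Continuous fun s : ℂ => (Complex.Gamma (1 - s))⁻¹ :=
    Complex.differentiable_one_div_Gamma.continuous.comp (by fun_prop : Continuous fun s : ℂ => 1 - s)
  have h := integrableOn_gammaFactor_mul hD (P := fun s => T s * (Complex.Gamma (1 - s))⁻¹)
    (b := fun s => besselSeries ((Complex.exp w₁ / 2) ^ 2) (-s)) (hT.1.mul hΓ.continuousOn)
    (fun s hs => ?_) ((continuousOn_besselSeries _).comp (by fun_prop) fun s => offIntegers_neg)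
    (fun s hs => hC _ (offIntegers_neg hs)) (w - (w₁ - Real.log 2)) e he a
  · refine h.congr_fun (fun u _ => ?_) measurableSet_Ioi
    simp only
    rw [besselI_eq_besselSeries (offIntegers_neg (he u)), ← sub_eq_add_neg,
      show ((u : ℂ) + e) * (w - (w₁ - Real.log 2)) =
        -(u + e) * (w₁ - Real.log 2) + (u + e) * w by ring, Complex.exp_add]
    ring
  · have h0 : -s ≠ 0 := by simpa using offIntegers_ne hs 0
    have h1 := Complex.Gamma_add_one _ h0
    rw [norm_mul, norm_mul, hT.2 s hs, show (1 : ℂ) - (s + 1) = -s by ring, sub_eq_add_neg,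
      add_comm 1, h1, norm_inv, norm_inv, norm_mul, norm_neg]
    have h2 : 0 < ‖s‖ := by simpa using h0
    calc ‖T s‖ * ‖Complex.Gamma (-s)‖⁻¹ = 1 * (‖s‖ * (‖T s‖ * (‖s‖ * ‖Complex.Gamma (-s)‖)⁻¹)) := by
          field_simp
      _ ≤ 4 * (‖s‖ * (‖T s‖ * (‖s‖ * ‖Complex.Gamma (-s)‖)⁻¹)) := by gcongr; norm_num
      _ = _ := by ring

theorem integrableOn_mul_besselI {D : Exponents} (hD : D.IsIntegral) {T : ℂ → ℂ}
    (hT : IsNormPeriodic T) (w₁ w e : ℂ) (he : ∀ u : ℝ, (u : ℂ) + e ∈ offIntegers) (a : ℝ) :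
    IntegrableOn (fun u : ℝ => T (u + e) * D.gammaFactor 1 (u + e) * besselI (u + e) w₁ *
      Complex.exp ((u + e) * w)) (Set.Ioi a) := by
  obtain ⟨C, hC⟩ := exists_norm_besselSeries_le ((Complex.exp w₁ / 2) ^ 2)
  have hΓ : Continuous fun s : ℂ => (Complex.Gamma (1 + s))⁻¹ :=
    Complex.differentiable_one_div_Gamma.continuous.comp (by fun_prop : Continuous fun s : ℂ => 1 + s)
  have h := integrableOn_gammaFactor_mul hD (P := fun s => T s * (Complex.Gamma (1 + s))⁻¹)
    (b := fun s => besselSeries ((Complex.exp w₁ / 2) ^ 2) s) (hT.1.mul hΓ.continuousOn)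
    (fun s hs => ?_) (continuousOn_besselSeries _) hC (w + (w₁ - Real.log 2)) e he a
  · refine h.congr_fun (fun u _ => ?_) measurableSet_Ioi
    simp only
    rw [besselI_eq_besselSeries (he u),
      show ((u : ℂ) + e) * (w + (w₁ - Real.log 2)) =
        (u + e) * (w₁ - Real.log 2) + (u + e) * w by ring, Complex.exp_add]
    ring
  · have h0 : 1 / 2 ≤ ‖1 + s‖ := by
      have := hs (-1)
      simpa [add_comm] using this
    have h0' : 1 / 2 ≤ ‖s‖ := by simpa using hs 0
    have h1 := Complex.Gamma_add_one (1 + s) (norm_pos_iff.1 (by linarith))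
    rw [norm_mul, norm_mul, hT.2 s hs, show (1 : ℂ) + (s + 1) = 1 + s + 1 by ring, h1, norm_inv,
      norm_inv, norm_mul, mul_inv]
    -- Both `‖1 + s‖` and `‖s‖` are at least `1 / 2`, so the two sides are separated by `2`; this is
    -- where the constant `4` originates.
    have h2 : ‖1 + s‖⁻¹ ≤ 4 * ‖s‖ := by
      refine (inv_anti₀ (by norm_num) h0).trans ?_
      linarith
    calc ‖T s‖ * (‖1 + s‖⁻¹ * ‖Complex.Gamma (1 + s)‖⁻¹)
        ≤ ‖T s‖ * (4 * ‖s‖ * ‖Complex.Gamma (1 + s)‖⁻¹) := by gcongr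
      _ = _ := by ring

theorem integrableOn_gammaFactor_mul_besselKernel {D : Exponents} (hD : D.IsIntegral) {j : ℕ}
    (hj : 1 ≤ j) (hjN : j ≤ D.N) (L : Kind) (w₁ w e : ℂ)
    (he : ∀ u : ℝ, (u : ℂ) + e ∈ offIntegers) (a : ℝ) :
    IntegrableOn (fun u : ℝ => D.gammaFactor j (u + e) * besselKernel L w₁ (u + e) *
      Complex.exp ((u + e) * w)) (Set.Ioi a) := by
  obtain ⟨T, hT, h⟩ := exists_gammaFactor_eq_mul hD hj hjN
  cases L
  · have h1 := integrableOn_mul_besselI_neg hD (hT.mul isNormPeriodic_inv_sin) w₁ w e he a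
    have h2 := integrableOn_mul_besselI hD
      ((hT.mul isNormPeriodic_inv_sin).mul (isNormPeriodic_const (-1))) w₁ w e he a
    refine IntegrableOn.congr_fun ((h1.add h2).const_mul (Real.pi / 2 : ℂ)) (fun u _ => ?_)
      measurableSet_Ioi
    simp only [besselKernel, Pi.add_apply]
    rw [h _ (he u), besselK_neg_eq (he u)]
    ring
  · refine (integrableOn_mul_besselI_neg hD hT w₁ w e he a).congr_fun (fun u _ => ?_)
      measurableSet_Ioi
    simp only [besselKernel]
    rw [h _ (he u)]

/-- The rays have imaginary part `±1`, and the vertical segment lies midway between two integers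
because the exponent is integral. -/
theorem mem_offIntegers_of_contour {a : ℝ} (ha : ∃ k : ℤ, a = k) {s : ℂ}
    (hs : |s.im| = 1 ∨ s.re = -a - 1 / 2) : s ∈ offIntegers := by
  rcases hs with hs | hs
  · exact offIntegers_of_im (by rw [hs]; norm_num)
  · obtain ⟨k, rfl⟩ := ha
    exact offIntegers_of_re (k := -k) (by rw [hs]; push_cast; ring)

theorem loopIntegrable_gammaFactor_mul_besselKernel {D : Exponents} (hD : D.IsIntegral) {j : ℕ}
    (hj : 1 ≤ j) (hjN : j ≤ D.N) (L : Kind) (w₁ w : ℂ) {a : ℝ} (ha : ∃ k : ℤ, a = k) :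
    LoopIntegrable (-a - 1 / 2) (fun s => D.gammaFactor j s * besselKernel L w₁ s *
      Complex.exp (s * w)) := by
  refine ⟨?_, Continuous.intervalIntegrable ?_ _ _, ?_⟩
  · simpa only [← sub_eq_add_neg] using integrableOn_gammaFactor_mul_besselKernel hD hj hjN L w₁ w
      (-Complex.I) (fun u => offIntegers_of_im (by simp; norm_num)) (-a - 1 / 2)
  · have h : ContinuousOn (fun s => D.gammaFactor j s * besselKernel L w₁ s *
        Complex.exp (s * w)) offIntegers :=
      ((continuousOn_gammaFactor hD hj hjN).mul (continuousOn_besselKernel L w₁)).mul (by fun_prop)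
    exact h.comp_continuous (by fun_prop) fun v => mem_offIntegers_of_contour ha (Or.inr (by simp))
  · exact integrableOn_gammaFactor_mul_besselKernel hD hj hjN L w₁ w
      Complex.I (fun u => offIntegers_of_im (by simp; norm_num)) (-a - 1 / 2)

/-! ### The effect of the shift operator -/

/-- If the symmetric Gamma factors of `D` and `D'` differ by the symbol of an Euler operator, then
this operator sends `f_j` for `D` to a multiple of `f_{j'}` for `D'`. -/
theorem shiftsToNonzeroMultiple_of_gammaFactor {D D' : Exponents} (hD : D.IsIntegral)
    (hD' : D'.IsIntegral) {j j' : ℕ} (hj : j ∈ Finset.Icc 1 D.N) (hj' : j' ∈ Finset.Icc 1 D'.N)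
    (hjj' : j = 1 ↔ j' = 1) (hα : D.α j = D'.α j') (c : ℕ → ℂ) (k : ℕ) {σ : ℂ} (hσ : σ ≠ 0)
    (h : ∀ s ∈ offIntegers, (∏ i ∈ Finset.range k, (s + c i)) * D.gammaFactor 1 s =
      σ * D'.gammaFactor 1 s) (L : Kind) :
    ShiftsToNonzeroMultiple (eulerProduct c k) L D j D' j' := by
  have hαj := hD.α_int j hj
  rw [Finset.mem_Icc] at hj hj'
  have hτ : ∃ τ : ℂ, τ ≠ 0 ∧ ∀ s ∈ offIntegers,
      (∏ i ∈ Finset.range k, (s + c i)) * D.gammaFactor j s = τ * D'.gammaFactor j' s := by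
    by_cases hj1 : j = 1
    · obtain rfl := hj1
      obtain rfl := hjj'.1 rfl
      exact ⟨σ, hσ, h⟩
    · obtain ⟨ρ, hρ, e⟩ := exists_gammaFactor_eq hD (by omega : 2 ≤ j) hj.2
      obtain ⟨ρ', hρ', e'⟩ := exists_gammaFactor_eq hD' (by omega : 2 ≤ j') hj'.2
      refine ⟨ρ * σ / ρ', div_ne_zero (mul_ne_zero hρ hσ) hρ', fun s hs => ?_⟩
      rw [e s hs, e' s hs]
      have h1 : ρ * σ / ρ' * (ρ' * Complex.sin (Real.pi * s) * D'.gammaFactor 1 s) =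
          ρ * σ * (Complex.sin (Real.pi * s) * D'.gammaFactor 1 s) := by
        field_simp
      rw [h1]
      linear_combination ρ * Complex.sin (Real.pi * s) * h s hs
  obtain ⟨τ, hτ0, hτ⟩ := hτ
  -- The choice between `log t_2` and `log (-t_2)` depends only on whether the place is `1`, which
  -- `j` and `j'` share.
  have hbr : branchOf (X := ℂ) L j = branchOf L j' := by
    ext xp xm
    cases L <;> simp only [branchOf, hjj']
  have hint := fun w₁ w => loopIntegrable_gammaFactor_mul_besselKernel hD hj.1 hj.2 L w₁ w hαj
  have hint' := fun w₁ w => loopIntegrable_gammaFactor_mul_besselKernel hD' hj'.1 hj'.2 L w₁ w hαj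
  refine ⟨fun w₁ wp wm => ⟨?_, ?_⟩, τ, hτ0, ?_⟩
  · simpa only [← integrand_eq] using hint w₁ (branchOf L j wp wm)
  · rw [← hα]
    simpa only [← integrand_eq] using hint' w₁ (branchOf L j' wp wm)
  intro U lp lm hU hlp hlm hexp w₁
  set l : ℂ → ℂ := fun t => branchOf L j (lp t) (lm t) with hl_def
  have hl : DifferentiableOn ℂ l U := by
    simp only [hl_def]
    cases L <;> by_cases hj1 : j = 1 <;> simp only [branchOf, hj1, if_true, if_false] <;> assumption
  have hl' : ∀ t ∈ U, t * deriv l t = 1 := by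
    intro t ht
    have hp : ∀ t ∈ U, Complex.exp (lp t) = 1 * t := fun t ht => by rw [one_mul, (hexp t ht).1]
    have hm : ∀ t ∈ U, Complex.exp (lm t) = (-1) * t := fun t ht => by
      rw [neg_one_mul, (hexp t ht).2]
    have hp' := mul_deriv_log_branch hU hlp one_ne_zero hp ht
    have hm' := mul_deriv_log_branch hU hlm (neg_ne_zero.2 one_ne_zero) hm ht
    simp only [hl_def]
    cases L <;> by_cases hj1 : j = 1 <;> simp only [branchOf, hj1, if_true, if_false] <;> assumption
  have hf : ∀ t, D.f L j w₁ (lp t) (lm t) = (1 / (2 * Real.pi * Complex.I)) *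
      loopIntegral (-D.α j - 1 / 2) (fun s => D.gammaFactor j s * besselKernel L w₁ s *
        Complex.exp (s * l t)) := fun t => by
    simp only [Exponents.f, hl_def, ← integrand_eq]
  simp only [hf]
  refine ⟨fun t ht => ?_, fun t ht => ?_⟩
  · have hlt := (hl.differentiableAt (hU.mem_nhds ht)).hasDerivAt
    exact (((hasDerivAt_loopIntegral (hint w₁) (l t)).2.comp t hlt).const_mul
      _).differentiableAt.differentiableWithinAt
  · rw [(eulerProduct_loopIntegral (hint w₁) hU hl hl' _ c k).2 t ht, Exponents.f, ← hα,
      mul_left_comm τ, ← loopIntegral_const_mul _ τ]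
    -- As `α_j = α'_{j'}`, both integrals run over the same loop, and the Gamma identity is needed
    -- only there.
    refine congrArg _ (loopIntegral_congr fun s hs => ?_)
    have hs' := mem_offIntegers_of_contour hαj hs
    rw [integrand_eq, ← hbr, ← mul_assoc, hτ s hs']
    ring

/-! ### Integrality and dominance of the parameters -/

theorem pairing_add_smul (n : ℕ) (Λ : ℕ → ℝ) {i j : ℕ} (hi : i ∈ Finset.Icc 1 (n + 1))
    (hj : j ∈ Finset.Icc 1 (n + 1)) (a b : ℝ) :
    pairing n Λ (a • basisWeight i + b • basisWeight j) = a * Λ i + b * Λ j := by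
  simp only [pairing, basisWeight, Pi.add_apply, Pi.smul_apply, smul_eq_mul, mul_add,
    Finset.sum_add_distrib, Pi.single_apply, mul_ite, mul_one, mul_zero, Finset.sum_ite_eq', hi, hj,
    if_true]
  ring

/-- This inequality decides the maximum and minimum in the definition of `α_1`, `α_2` when `μ = m -
1`. -/
theorem le_of_mem_Xi {n m : ℕ} {ε : ℤˣ} {Λ : ℕ → ℝ} (hΛ : Λ ∈ Xi n m ε) (hm : 1 ≤ m)
    (hmn : m ≤ n) : Λ m ≤ ((ε : ℤ) : ℝ) * Λ (n + 1) := by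
  have h := hΛ.2 (((ε : ℤ) : ℝ) • basisWeight (n + 1) + (((-1 : ℤˣ) : ℤ) : ℝ) • basisWeight m)
    (Or.inr ⟨m, le_rfl, hmn, -1, rfl⟩)
  rw [pairing_add_smul n Λ (by simp) (by simp; omega)] at h
  push_cast at h
  linarith

theorem exists_eq_add_int_of_mem_Xi {n m : ℕ} {ε : ℤˣ} {Λ : ℕ → ℝ} (hΛ : Λ ∈ Xi n m ε)
    (hn : 1 ≤ n) {i : ℕ} (hi : i ∈ Finset.Icc 1 (n + 1)) : ∃ k : ℤ, Λ i = Λ n + k := by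
  have hn' : n ∈ Finset.Icc 1 (n + 1) := by simp; omega
  rcases hΛ.1.2.2 with h | h <;>
  · obtain ⟨k, hk⟩ := h i hi
    obtain ⟨l, hl⟩ := h n hn'
    refine ⟨k - l + i - n, ?_⟩
    push_cast
    linarith

theorem exists_two_mul_of_mem_Xi {n m : ℕ} {ε : ℤˣ} {Λ : ℕ → ℝ} (hΛ : Λ ∈ Xi n m ε)
    (hn : 1 ≤ n) : ∃ k : ℤ, 2 * Λ n = k := by
  have hn' : n ∈ Finset.Icc 1 (n + 1) := by simp; omega
  rcases hΛ.1.2.2 with h | h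
  · obtain ⟨l, hl⟩ := h n hn'
    refine ⟨2 * (l - 1), ?_⟩
    push_cast
    linarith
  · obtain ⟨l, hl⟩ := h n hn'
    refine ⟨2 * l - 1, ?_⟩
    push_cast
    linarith

theorem exists_blattner_eq {n m : ℕ} {ε : ℤˣ} {Λ : ℕ → ℝ} (hΛ : Λ ∈ Xi n m ε)
    (hn : 1 ≤ n) {i : ℕ} (hi : i ∈ Finset.Icc 1 n) : ∃ k : ℤ, blattner n m Λ i = Λ n + k := by
  obtain ⟨k, hk⟩ := exists_eq_add_int_of_mem_Xi hΛ hn (i := i) (by simp at hi ⊢; omega)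
  rw [blattner]
  split_ifs
  · exact ⟨k - n + i + 1, by push_cast; linarith⟩
  · exact ⟨k - n + i, by push_cast; linarith⟩

theorem IsGT.exists_eq_add_int {n : ℕ} {lam : ℕ → ℝ} {Q : ℕ → ℕ → ℝ} (hQ : IsGT n lam Q)
    (hn : 1 ≤ n) {c : ℝ} (hc : ∃ k : ℤ, lam n = c + k) {i j : ℕ}
    (hi : i ∈ Finset.Icc 1 (2 * n - 1)) (hj : j ∈ Finset.Icc 1 ((i + 1) / 2)) :
    ∃ k : ℤ, Q i j = c + k := by
  obtain ⟨l, hl⟩ := hc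
  have ht := hQ.top n (by simp; omega)
  rcases hQ.integral with h | h <;>
  · obtain ⟨k, hk⟩ := h i hi j hj
    obtain ⟨k', hk'⟩ := h (2 * n - 1) (by simp; omega) n (by simp; omega)
    refine ⟨k - k' + l, ?_⟩
    push_cast
    linarith

/-! ### Shifts of Gelfand–Tsetlin patterns -/

theorem shiftRow_of_ne {a i j : ℕ} {b : ℤ} (Q : ℕ → ℕ → ℝ) (h : i ≠ a ∨ j ≠ b.natAbs) :
    shiftRow a b Q i j = Q i j :=
  if_neg (by tauto)

theorem shiftRow_self (a : ℕ) (b : ℤ) (Q : ℕ → ℕ → ℝ) :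
    shiftRow a b Q a b.natAbs = Q a b.natAbs + b.sign :=
  if_pos ⟨rfl, rfl⟩

theorem IsGT.integral_shiftRow {n : ℕ} {lam : ℕ → ℝ} {Q : ℕ → ℕ → ℝ} (hQ : IsGT n lam Q)
    (a : ℕ) (b : ℤ) :
    (∀ i ∈ Finset.Icc 1 (2 * n - 1), ∀ j ∈ Finset.Icc 1 ((i + 1) / 2),
      ∃ k : ℤ, shiftRow a b Q i j = k) ∨
    (∀ i ∈ Finset.Icc 1 (2 * n - 1), ∀ j ∈ Finset.Icc 1 ((i + 1) / 2),
      ∃ k : ℤ, shiftRow a b Q i j = k + 1 / 2) := by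
  refine hQ.integral.imp (fun h i hi j hj => ?_) (fun h i hi j hj => ?_) <;>
  · obtain ⟨k, hk⟩ := h i hi j hj
    rw [shiftRow, hk]
    split_ifs
    · exact ⟨k + b.sign, by push_cast; ring⟩
    · exact ⟨k, rfl⟩

/-- When entry `p` of row `2n - 2` can be raised. -/
theorem IsGT.shiftRow_pos_iff {n : ℕ} {lam : ℕ → ℝ} {Q : ℕ → ℕ → ℝ} (hQ : IsGT n lam Q) {p : ℕ}
    (hp : 1 ≤ p) (hpn : p ≤ n - 1) : IsGT n lam (shiftRow (2 * n - 2) (p : ℤ) Q) ↔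
      Q (2 * n - 2) p + 1 ≤ lam p ∧ (2 ≤ p → Q (2 * n - 2) p + 1 ≤ Q (2 * n - 3) (p - 1)) := by
  obtain ⟨N, rfl⟩ : ∃ N, n = N + 1 := ⟨n - 1, by omega⟩
  rw [show 2 * (N + 1) - 3 = 2 * N - 1 by omega, show 2 * (N + 1) - 2 = 2 * N by omega]
  have hself : shiftRow (2 * N) (p : ℤ) Q (2 * N) p = Q (2 * N) p + 1 := by
    have h := shiftRow_self (2 * N) (p : ℤ) Q
    simpa [Int.sign_natCast_of_ne_zero (by omega : p ≠ 0)] using h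
  have hne : ∀ i j, i ≠ 2 * N ∨ j ≠ p →
      shiftRow (2 * N) (p : ℤ) Q i j = Q i j := fun i j h =>
    shiftRow_of_ne Q (by simpa using h)
  have hodd : ∀ i j, shiftRow (2 * N) (p : ℤ) Q (2 * i + 1) j = Q (2 * i + 1) j :=
    fun i j => hne _ _ (by omega)
  have hodd' : ∀ i j, 1 ≤ i → shiftRow (2 * N) (p : ℤ) Q (2 * i - 1) j =
      Q (2 * i - 1) j := fun i j _ => hne _ _ (by omega)
  have hge : ∀ i j, Q i j ≤ shiftRow (2 * N) (p : ℤ) Q i j := by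
    intro i j
    by_cases h : i ≠ 2 * N ∨ j ≠ p
    · exact (hne i j h).ge
    · push Not at h
      rw [h.1, h.2, hself]
      linarith
  have htop := hQ.top p (by simp; omega)
  rw [show 2 * (N + 1) - 1 = 2 * N + 1 by omega] at htop
  constructor
  · intro h
    constructor
    · have h1 : shiftRow (2 * N) (p : ℤ) Q (2 * N) p ≤ Q (2 * N + 1) p := by
        rw [← hodd]
        rcases (by omega : p = N ∨ p ≤ N - 1) with rfl | hpN
        · exact (h.odd_even_last p (by simp; omega)).1
        · exact (h.odd_even N (by simp; omega) p (by simp; omega)).1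
      rw [← htop]
      linarith
    · intro hp2
      have h1 := (h.even_odd N (by simp; omega) (p - 1) (by simp; omega)).2
      rwa [Nat.sub_add_cancel hp, hself, hodd' _ _ (by omega)] at h1
  · rintro ⟨h1, h2⟩
    refine ⟨hQ.integral_shiftRow _ _, fun i hi j hj => ?_, fun i hi => ?_, fun i hi j hj => ?_,
      fun i hi => ?_, fun j hj => ?_⟩
    · rw [hodd, hodd]
      have h := hQ.odd_even i hi j hj
      refine ⟨?_, h.2.trans (hge _ _)⟩
      by_cases hc : 2 * i ≠ 2 * N ∨ j ≠ p
      · rw [hne _ _ hc]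
        exact h.1
      · obtain ⟨h3, rfl⟩ : i = N ∧ j = p := by omega
        rw [h3, hself, htop]
        exact h1
    · rw [hodd, hodd]
      have h := hQ.odd_even_last i hi
      refine ⟨?_, h.2.trans (hge _ _)⟩
      by_cases hc : 2 * i ≠ 2 * N ∨ i ≠ p
      · rw [hne _ _ hc]
        exact h.1
      · obtain ⟨h3, h4⟩ : i = N ∧ i = p := by omega
        rw [show shiftRow (2 * N) (p : ℤ) Q (2 * i) i = Q (2 * N) p + 1 by rw [← hself, h4.symm, h3],
          show Q (2 * i + 1) i = lam p by rw [← htop, ← h3, h4]]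
        exact h1
    · rw [Finset.mem_Icc] at hi hj
      rw [hodd' _ _ hi.1]
      have h := hQ.even_odd i (by simp; omega) j (by simp; omega)
      refine ⟨h.1.trans (hge _ _), ?_⟩
      by_cases hc : 2 * i ≠ 2 * N ∨ j + 1 ≠ p
      · rw [hne _ _ hc]
        exact h.2
      · obtain ⟨h3, rfl⟩ : i = N ∧ j + 1 = p := by omega
        rw [h3, hself]
        exact h2 (by omega)
    · rw [Finset.mem_Icc] at hi
      rw [hodd' _ _ hi.1]
      have h := hQ.even_odd_last i (by simp; omega)
      exact ⟨h.1.trans (hge _ _), (neg_le_neg (hge _ _)).trans h.2⟩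
    · rw [show 2 * (N + 1) - 1 = 2 * N + 1 by omega, hodd]
      exact hQ.top j hj

/-- When entry `p` of row `2n - 2` can be lowered. -/
theorem IsGT.shiftRow_neg_iff {n : ℕ} {lam : ℕ → ℝ} {Q : ℕ → ℕ → ℝ} (hQ : IsGT n lam Q) {p : ℕ}
    (hp : 1 ≤ p) (hpn : p ≤ n - 1) : IsGT n lam (shiftRow (2 * n - 2) (-(p : ℤ)) Q) ↔
      (p < n - 1 → lam (p + 1) ≤ Q (2 * n - 2) p - 1) ∧
      (p = n - 1 → |lam n| ≤ Q (2 * n - 2) p - 1 ∧ -(Q (2 * n - 2) p - 1) ≤ Q (2 * n - 3) p) ∧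
      Q (2 * n - 3) p ≤ Q (2 * n - 2) p - 1 := by
  obtain ⟨N, rfl⟩ : ∃ N, n = N + 1 := ⟨n - 1, by omega⟩
  rw [show 2 * (N + 1) - 3 = 2 * N - 1 by omega, show 2 * (N + 1) - 2 = 2 * N by omega,
    show N + 1 - 1 = N by omega]
  have hself : shiftRow (2 * N) (-(p : ℤ)) Q (2 * N) p = Q (2 * N) p - 1 := by
    have h := shiftRow_self (2 * N) (-(p : ℤ)) Q
    simpa [Int.sign_natCast_of_ne_zero (by omega : p ≠ 0), ← sub_eq_add_neg] using h
  have hne : ∀ i j, i ≠ 2 * N ∨ j ≠ p →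
      shiftRow (2 * N) (-(p : ℤ)) Q i j = Q i j := fun i j h =>
    shiftRow_of_ne Q (by simpa using h)
  have hodd : ∀ i j, shiftRow (2 * N) (-(p : ℤ)) Q (2 * i + 1) j = Q (2 * i + 1) j :=
    fun i j => hne _ _ (by omega)
  have hodd' : ∀ i j, 1 ≤ i → shiftRow (2 * N) (-(p : ℤ)) Q (2 * i - 1) j =
      Q (2 * i - 1) j := fun i j _ => hne _ _ (by omega)
  have hle : ∀ i j, shiftRow (2 * N) (-(p : ℤ)) Q i j ≤ Q i j := by
    intro i j
    by_cases h : i ≠ 2 * N ∨ j ≠ p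
    · exact (hne i j h).le
    · push Not at h
      rw [h.1, h.2, hself]
      linarith
  have htop := hQ.top (p + 1) (by simp; omega)
  rw [show 2 * (N + 1) - 1 = 2 * N + 1 by omega] at htop
  constructor
  · intro h
    refine ⟨fun hpN => ?_, fun hpN => ?_, ?_⟩
    · have h1 := (h.odd_even N (by simp; omega) p (by simp; omega)).2
      rwa [hodd, hself, htop] at h1
    · obtain rfl := hpN
      have h1 := (h.odd_even_last p (by simp; omega)).2
      have h2 := (h.even_odd_last p (by simp; omega)).2
      rw [hodd, hself, htop] at h1
      rw [hself, hodd' _ _ hp] at h2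
      exact ⟨h1, h2⟩
    · rcases (by omega : p = N ∨ p ≤ N - 1) with rfl | hpN
      · have h1 := (h.even_odd_last p (by simp; omega)).1
        rwa [hself, hodd' _ _ hp] at h1
      · have h1 := (h.even_odd N (by simp; omega) p (by simp; omega)).1
        rwa [hself, hodd' _ _ (by omega)] at h1
  · rintro ⟨h1, h2, h3⟩
    refine ⟨hQ.integral_shiftRow _ _, fun i hi j hj => ?_, fun i hi => ?_, fun i hi j hj => ?_,
      fun i hi => ?_, fun j hj => ?_⟩
    · rw [hodd, hodd]
      have h := hQ.odd_even i hi j hj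
      refine ⟨(hle _ _).trans h.1, ?_⟩
      by_cases hc : 2 * i ≠ 2 * N ∨ j ≠ p
      · rw [hne _ _ hc]
        exact h.2
      · obtain ⟨h4, rfl⟩ : i = N ∧ j = p := by omega
        rw [h4, hself, htop]
        exact h1 (by simp at hj; omega)
    · rw [hodd, hodd]
      have h := hQ.odd_even_last i hi
      refine ⟨(hle _ _).trans h.1, ?_⟩
      by_cases hc : 2 * i ≠ 2 * N ∨ i ≠ p
      · rw [hne _ _ hc]
        exact h.2
      · obtain ⟨rfl, rfl⟩ : i = N ∧ i = p := by omega
        rw [hself, htop]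
        exact (h2 rfl).1
    · rw [Finset.mem_Icc] at hi hj
      rw [hodd' _ _ hi.1]
      have h := hQ.even_odd i (by simp; omega) j (by simp; omega)
      refine ⟨?_, (hle _ _).trans h.2⟩
      by_cases hc : 2 * i ≠ 2 * N ∨ j ≠ p
      · rw [hne _ _ hc]
        exact h.1
      · obtain ⟨rfl, rfl⟩ : i = N ∧ j = p := by omega
        rw [hself]
        exact h3
    · rw [Finset.mem_Icc] at hi
      rw [hodd' _ _ hi.1]
      have h := hQ.even_odd_last i (by simp; omega)
      by_cases hc : 2 * i ≠ 2 * N ∨ i ≠ p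
      · rw [hne _ _ hc]
        exact h
      · obtain ⟨rfl, rfl⟩ : i = N ∧ i = p := by omega
        rw [hself]
        exact ⟨h3, (h2 rfl).2⟩
    · rw [show 2 * (N + 1) - 1 = 2 * N + 1 by omega, hodd]
      exact hQ.top j hj

/-! ### The patterns `Q_{m'}^+` and `Q_{m'-1}^-` -/

/-- The relations between the entries of `Q_{m'}^+` and `Q_{m'-1}^-` that determine their
exponents. -/
structure IsAdjacent (n m m' : ℕ) (lam : ℕ → ℝ) (Qp Qm : ℕ → ℕ → ℝ) : Prop where
  two_le : 2 ≤ m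
  le : m ≤ m'
  lt : m' ≤ n - 1
  gt_plus : IsGT n lam Qp
  gt_minus : IsGT n lam Qm
  even_first : Qp (2 * n - 2) (m - 1) = lam m ∧ Qm (2 * n - 2) (m - 1) = lam m
  even_left : ∀ p, m - 1 ≤ p → p ≤ m' - 1 → Qp (2 * n - 2) p = Qm (2 * n - 2) p
  odd_left : ∀ p, m - 1 ≤ p → p + 1 ≤ m' - 1 → Qp (2 * n - 3) p = Qm (2 * n - 3) p
  even_right : ∀ p, m' + 1 ≤ p → p ≤ n - 1 → Qp (2 * n - 2) p = Qm (2 * n - 2) p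
  odd_right : ∀ p, m' + 1 ≤ p → p ≤ n - 1 → Qp (2 * n - 3) p = Qm (2 * n - 3) p
  even_mid : Qp (2 * n - 2) m' = Qp (2 * n - 4) (m' - 1) ∧ Qm (2 * n - 2) m' = lam m'
  odd_mid : Qp (2 * n - 3) (m' - 1) = Qp (2 * n - 4) (m' - 1) ∧
    Qm (2 * n - 3) m' = Qp (2 * n - 4) (m' - 1)
  succ_le : m' < n - 1 → lam (m' + 1) ≤ Qp (2 * n - 4) (m' - 1)
  abs_le : m' = n - 1 → |lam n| ≤ Qp (2 * n - 4) (m' - 1)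

theorem isAdjacent_of_isQPlus_of_isQMinus {n m m' : ℕ} (hm : 2 ≤ m) (hmm' : m ≤ m')
    (hm'n : m' ≤ n - 1) {lam : ℕ → ℝ} {Qp Qm : ℕ → ℕ → ℝ} (hQp : IsQPlus n m m' lam Qp)
    (hQm : IsQMinus n m (m' - 1) lam Qm)
    (hrows : ∀ i ∈ Finset.Icc 1 (2 * n - 4), ∀ k ∈ Finset.Icc 1 ((i + 1) / 2), Qp i k = Qm i k) :
    IsAdjacent n m m' lam Qp Qm := by
  obtain ⟨hp, hp'⟩ := hQp
  obtain ⟨hq, hq'⟩ := hQm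
  rw [if_pos hmm'] at hp'
  have hrow : ∀ k, 1 ≤ k → k ≤ n - 2 → Qp (2 * n - 4) k = Qm (2 * n - 4) k := fun k h1 h2 =>
    hrows _ (by simp; omega) _ (by simp; omega)
  -- Place `m' - 1` is the middle place of `Q_{m'-1}^-`, and its endpoint condition continues the
  -- pattern of the places to the left.
  have heven : ∀ p, m - 1 ≤ p → p ≤ m' - 1 → Qm (2 * n - 2) p = lam (p + 1) := by
    intro p h1 h2
    rcases h2.lt_or_eq with h2 | rfl
    · exact (hq.left p h1 h2).1
    · exact hq'
  have hmid := hq.right m' (by simp; omega)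
  refine ⟨hm, hmm', hm'n, hp.isGT, hq.isGT, ⟨?_, ?_⟩, fun p h1 h2 => ?_, fun p h1 h2 => ?_,
    fun p h1 h2 => ?_, fun p h1 h2 => ?_, ⟨hp', hmid.1⟩, ⟨?_, ?_⟩, fun h => ?_, fun h => ?_⟩
  · rw [(hp.left (m - 1) le_rfl (by omega)).1, Nat.sub_add_cancel (by omega)]
  · rw [heven (m - 1) le_rfl (by omega), Nat.sub_add_cancel (by omega)]
  · rw [(hp.left p h1 (by omega)).1, heven p h1 h2]
  · rw [(hp.left p h1 (by omega)).2, (hq.left p h1 (by omega)).2, hrow p (by omega) (by omega)]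
  · rw [(hp.right p (by simp; omega)).1, (hq.right p (by simp; omega)).1]
  · rw [(hp.right p (by simp; omega)).2, (hq.right p (by simp; omega)).2,
      hrow _ (by omega) (by omega)]
  · exact (hp.left (m' - 1) (by omega) (by omega)).2
  · rw [hmid.2, hrow _ (by omega) (by omega)]
  · have h1 := (hp.row_high (m' - 1) (by simp; omega)).2
    rwa [show m' - 1 + 2 = m' + 1 by omega] at h1
  · have h1 := hp.row_last.2
    rwa [show n - 2 = m' - 1 by omega] at h1

namespace IsAdjacent

variable {n m m' : ℕ} {lam : ℕ → ℝ} {Qp Qm : ℕ → ℕ → ℝ}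

/-- In `Q_{m'}^+` the entry at `m'` already equals its upper neighbour `q_{2n-3,m'-1}`, so it cannot
be raised. At the remaining places the relevant entries of the two patterns agree. -/
theorem jList_eq (h : IsAdjacent n m m' lam Qp Qm) :
    jList n m m' lam Qp = jList n m (m' - 1) lam Qm := by
  obtain ⟨h2, hle, hlt⟩ := And.intro h.two_le (And.intro h.le h.lt)
  rw [jList, jList]
  congr 1
  ext j
  simp only [Finset.mem_inter, K6, Finset.mem_filter, Finset.mem_union, Finset.mem_Icc]
  by_cases hj : (m : ℤ) ≤ j ∧ j ≤ m'
  · obtain ⟨p, rfl⟩ := Int.eq_ofNat_of_zero_le (by omega : 0 ≤ j)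
    have e1 := h.gt_plus.shiftRow_pos_iff (p := p) (by omega) (by omega)
    have e2 := h.gt_minus.shiftRow_pos_iff (p := p) (by omega) (by omega)
    rw [e1, e2]
    by_cases hp : p = m'
    · subst hp
      have := h.even_mid.1
      have := h.odd_mid.1
      constructor
      · rintro ⟨⟨-, -, h3⟩, -⟩
        have := h3 (by omega)
        linarith
      · rintro ⟨-, h3⟩
        omega
    · rw [h.even_left p (by omega) (by omega), h.odd_left (p - 1) (by omega) (by omega)]
      have a1 : (m : ℤ) - 1 ≤ p ∧ (p : ℤ) ≤ m' := by omega
      have a2 : (m : ℤ) - 1 ≤ p ∧ (p : ℤ) ≤ (m' - 1 : ℕ) := by omega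
      have a3 : (m : ℤ) ≤ p ∧ (p : ℤ) ≤ (m' - 1 : ℕ) := by omega
      simp only [a1, a2, a3, true_or, true_and, and_true]
  · have a3 : ¬((m : ℤ) ≤ j ∧ j ≤ (m' - 1 : ℕ)) := by omega
    simp only [hj, a3, and_false]

/-- In `Q_{m'-1}^-` the entry at `m'` is `λ_{m'}`, with `q_{2n-4,m'-1}` below it in row `2n - 3`. A
gap of at least one makes it lowerable; nothing changes further to the right. -/
theorem kSet_eq (h : IsAdjacent n m m' lam Qp Qm) (hstep : Qp (2 * n - 4) (m' - 1) ≤ lam m' - 1) :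
    K6 n m (m' - 1) lam Qm ∩ Finset.Icc (-(n : ℤ) + 1) (-((m' - 1 : ℕ) : ℤ) - 1) =
      insert (-(m' : ℤ))
        (K6 n m m' lam Qp ∩ Finset.Icc (-(n : ℤ) + 1) (-(m' : ℤ) - 1)) := by
  obtain ⟨h2, hle, hlt⟩ := And.intro h.two_le (And.intro h.le h.lt)
  ext j
  simp only [Finset.mem_insert, Finset.mem_inter, K6, Finset.mem_filter, Finset.mem_union,
    Finset.mem_Icc]
  by_cases hj : -(n : ℤ) + 1 ≤ j ∧ j ≤ -(m' : ℤ)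
  · obtain ⟨p, hp⟩ := Int.eq_ofNat_of_zero_le (by omega : 0 ≤ -j)
    obtain rfl : j = -(p : ℤ) := by omega
    have e1 := h.gt_plus.shiftRow_neg_iff (p := p) (by omega) (by omega)
    have e2 := h.gt_minus.shiftRow_neg_iff (p := p) (by omega) (by omega)
    rw [e1, e2]
    have a1 : -(n : ℤ) + 1 ≤ -p ∧ -(p : ℤ) ≤ -((m' - 1 : ℕ) : ℤ) := by omega
    have a2 : -(n : ℤ) + 1 ≤ -p ∧ -(p : ℤ) ≤ -((m' - 1 : ℕ) : ℤ) - 1 := by omega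
    by_cases hpm : p = m'
    · subst hpm
      simp only [a1, a2, or_true, true_and, and_true, true_or, iff_true, h.even_mid.2, h.odd_mid.2]
      -- For `m' = n - 1` the lower neighbour enters through `|λ_n|`, and its nonnegativity also
      -- gives the sign condition.
      refine ⟨fun h1 => (h.succ_le h1).trans hstep, fun h1 => ?_, hstep⟩
      have h3 := h.abs_le h1
      have h4 := abs_nonneg (lam n)
      exact ⟨by linarith, by linarith⟩
    · rw [h.even_right p (by omega) (by omega), h.odd_right p (by omega) (by omega)]
      have a4 : -(n : ℤ) + 1 ≤ -p ∧ -(p : ℤ) ≤ -(m' : ℤ) - 1 := by omega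
      have a5 : ¬ -(p : ℤ) = -(m' : ℤ) := by omega
      simp only [a1, a2, hj, a4, a5, or_true, true_and, and_true, false_or]
  · have a1 : ¬(-(n : ℤ) + 1 ≤ j ∧ j ≤ -((m' - 1 : ℕ) : ℤ) - 1) := by omega
    have a2 : ¬(-(n : ℤ) + 1 ≤ j ∧ j ≤ -(m' : ℤ) - 1) := by omega
    have a3 : ¬ j = -(m' : ℤ) := by omega
    simp only [a1, a2, a3, and_false, or_false]

theorem kList_eq (h : IsAdjacent n m m' lam Qp Qm) (hstep : Qp (2 * n - 4) (m' - 1) ≤ lam m' - 1) :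
    kList n m (m' - 1) lam Qm = kList n m m' lam Qp ++ [-(m' : ℤ)] := by
  have hnot : -(m' : ℤ) ∉ K6 n m m' lam Qp ∩ Finset.Icc (-(n : ℤ) + 1) (-(m' : ℤ) - 1) := by
    simp
  rw [kList, kList, h.kSet_eq hstep]
  refine List.Perm.eq_of_pairwise (le := (· ≤ ·)) (fun a b _ _ => le_antisymm)
    (Finset.pairwise_sort _ _) ?_ ?_
  · refine List.pairwise_append.2 ⟨Finset.pairwise_sort _ _, List.pairwise_singleton _ _, ?_⟩
    intro a ha b hb
    rw [Finset.mem_sort, Finset.mem_inter, Finset.mem_Icc] at ha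
    rw [List.mem_singleton] at hb
    omega
  · refine (Finset.sort_perm_toList _ _).trans ((Finset.toList_insert hnot).trans ?_)
    exact ((Finset.sort_perm_toList _ _).symm.cons _).trans (List.perm_append_singleton _ _).symm

theorem increasingNumbering_eq (h : IsAdjacent n m m' lam Qp Qm)
    (hstep : Qp (2 * n - 4) (m' - 1) ≤ lam m' - 1) :
    increasingNumbering n m (m' - 1) lam Qm =
      increasingNumbering n m m' lam Qp ++ [-(m' : ℤ)] := by
  rw [increasingNumbering, increasingNumbering, ← h.jList_eq, h.kList_eq hstep, List.append_assoc]

theorem frontNumbering_eq (h : IsAdjacent n m m' lam Qp Qm)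
    (hstep : Qp (2 * n - 4) (m' - 1) ≤ lam m' - 1) :
    frontNumbering n m (m' - 1) lam Qm =
      jList n m m' lam Qp ++ -(m' : ℤ) :: kList n m m' lam Qp := by
  have e : -((m' - 1 : ℕ) : ℤ) - 1 = -(m' : ℤ) := by
    have := h.two_le
    have := h.le
    omega
  have hnot : -(m' : ℤ) ∉ kList n m m' lam Qp := by
    simp [kList]
  rw [frontNumbering, e, ← h.jList_eq, h.kList_eq hstep, List.erase_append_right _ hnot]
  simp

theorem mem_increasingNumbering (h : IsAdjacent n m m' lam Qp Qm) {j : ℤ}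
    (hj : j ∈ increasingNumbering n m m' lam Qp) :
    (m : ℤ) ≤ j ∧ j ≤ m' - 1 ∨ -(n : ℤ) + 1 ≤ j ∧ j ≤ -(m' : ℤ) - 1 := by
  have := h.two_le
  have := h.le
  rw [increasingNumbering, h.jList_eq, List.mem_append, jList, kList, Finset.mem_sort,
    Finset.mem_sort, Finset.mem_inter, Finset.mem_inter, Finset.mem_Icc, Finset.mem_Icc] at hj
  omega

end IsAdjacent

/-! ### The exponents of a numbering -/

/-- Rewrites products over places as products over the index list, where permutation invariance is
available. List position `0` is place `3`. -/
theorem prod_Icc_three_getD {M : Type*} [CommMonoid M] (f : ℤ → M) (idx : List ℤ) :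
    ∏ p ∈ Finset.Icc 3 (idx.length + 2), f (idx.getD (p - 3) 0) = (idx.map f).prod := by
  induction idx using List.reverseRecOn with
  | nil => simp
  | append_singleton l x ih =>
    rw [List.length_append, List.length_singleton, add_right_comm,
      Finset.prod_Icc_succ_top (by omega), List.map_append, List.prod_append, ← ih]
    congr 1
    · refine Finset.prod_congr rfl fun p hp => ?_
      rw [Finset.mem_Icc] at hp
      rw [List.getD_append _ _ _ _ (by omega)]
    · rw [List.getD_append_right _ _ _ _ (by omega)]
      simp

/-- `α` as a function of the index `j`. -/
def alphaAt (n : ℕ) (ε : ℤˣ) (Λ : ℕ → ℝ) (Q : ℕ → ℕ → ℝ) (j : ℤ) : ℝ :=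
  ((ε : ℤ) : ℝ) * Λ n + (lEven (n - 1) Q j - 1)

/-- `β` as a function of the index `j`. -/
def betaAt (n : ℕ) (ε : ℤˣ) (Λ : ℕ → ℝ) (Q : ℕ → ℕ → ℝ) (j : ℤ) : ℝ :=
  ((ε : ℤ) : ℝ) * Λ n + if 0 < j then lOdd (n - 1) Q (j - 1) else lOdd (n - 1) Q j

theorem exponents_α_of_three_le (n m μ : ℕ) (ε : ℤˣ) (Λ : ℕ → ℝ) (Q : ℕ → ℕ → ℝ) (idx : List ℤ)
    {p : ℕ} (hp : 3 ≤ p) : (exponents n m μ ε Λ Q idx).α p = alphaAt n ε Λ Q (idx.getD (p - 3) 0) := by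
  simp only [exponents, alphaAt, if_neg (show p ≠ 1 by omega), if_neg (show p ≠ 2 by omega)]

theorem gammaFactor_one_exponents (n m μ : ℕ) (ε : ℤˣ) (Λ : ℕ → ℝ) (Q : ℕ → ℕ → ℝ) (idx : List ℤ)
    (s : ℂ) : (exponents n m μ ε Λ Q idx).gammaFactor 1 s =
      Complex.Gamma (-((exponents n m μ ε Λ Q idx).α 1 : ℂ) - s) *
      Complex.Gamma (-((exponents n m μ ε Λ Q idx).α 2 : ℂ) - s) *
      (idx.map fun j => Complex.Gamma (-(alphaAt n ε Λ Q j : ℂ) - s) /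
        Complex.Gamma (1 - (betaAt n ε Λ Q j : ℂ) - s)).prod := by
  have e : Finset.Icc 1 (idx.length + 2) = insert 1 (insert 2 (Finset.Icc 3 (idx.length + 2))) := by
    ext p
    simp only [Finset.mem_insert, Finset.mem_Icc]
    omega
  have hα : ∀ p ∈ Finset.Icc 3 (idx.length + 2),
      Complex.Gamma (-((exponents n m μ ε Λ Q idx).α p : ℂ) - s) =
        Complex.Gamma (-(alphaAt n ε Λ Q (idx.getD (p - 3) 0) : ℂ) - s) := fun p hp => by
    rw [exponents_α_of_three_le _ _ _ _ _ _ _ (Finset.mem_Icc.1 hp).1]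
  rw [← prod_Icc_three_getD, gammaFactor_one, Finset.prod_div_distrib,
    show (exponents n m μ ε Λ Q idx).N = idx.length + 2 from rfl, e,
    Finset.prod_insert (by simp), Finset.prod_insert (by simp), Finset.prod_congr rfl hα]
  simp only [div_eq_mul_inv]
  rw [← mul_assoc, ← mul_assoc]
  rfl

/-- Because `2 * x` is an integer, `x` and `-x` agree modulo integers and the signs do not matter.
-/
theorem exists_int_sign_mul_add {x : ℝ} (hx : ∃ k : ℤ, 2 * x = k) (ε : ℤˣ) {y : ℝ}
    (hy : ∃ k : ℤ, y = x + k ∨ y = -x + k) : ∃ k : ℤ, ((ε : ℤ) : ℝ) * x + y = k := by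
  obtain ⟨k, hk⟩ := hx
  obtain ⟨l, rfl | rfl⟩ := hy <;> rcases Int.units_eq_one_or ε with rfl | rfl
  · exact ⟨k + l, by push_cast; linarith⟩
  · exact ⟨l, by push_cast; ring⟩
  · exact ⟨l, by push_cast; ring⟩
  · exact ⟨l - k, by push_cast; linarith⟩

theorem exists_lEven_eq {n : ℕ} {c : ℝ} {Q : ℕ → ℕ → ℝ} {j : ℤ} (hj : j ≠ 0)
    (hQ : ∃ k : ℤ, Q (2 * n) j.natAbs = c + k) :
    ∃ k : ℤ, lEven n Q j = c + k ∨ lEven n Q j = -c + k := by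
  obtain ⟨k, hk⟩ := hQ
  rw [lEven, hk]
  generalize j.natAbs = a
  split_ifs with h h'
  · exact ⟨k + n + 1 - a, Or.inl (by push_cast; ring)⟩
  · exact ⟨-(k + n + 1 - a) + 1, Or.inr (by push_cast; ring)⟩
  · omega

theorem exists_lOdd_eq {n : ℕ} {c : ℝ} {Q : ℕ → ℕ → ℝ} {j : ℤ} (hj : j ≠ 0)
    (hQ : ∃ k : ℤ, Q (2 * n - 1) j.natAbs = c + k) :
    ∃ k : ℤ, lOdd n Q j = c + k ∨ lOdd n Q j = -c + k := by
  obtain ⟨k, hk⟩ := hQ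
  rw [lOdd, hk]
  generalize j.natAbs = a
  rcases lt_or_gt_of_ne hj with h | h
  · rw [Int.sign_eq_neg_one_of_neg h]
    exact ⟨-(k + n - a), Or.inr (by push_cast; ring)⟩
  · rw [Int.sign_eq_one_of_pos h]
    exact ⟨k + n - a, Or.inl (by push_cast; ring)⟩

theorem isIntegral_exponents {n m μ : ℕ} {ε : ℤˣ} {Λ : ℕ → ℝ} (hΛ : Λ ∈ Xi n m ε) (hm : 2 ≤ m)
    (hmn : m ≤ n - 1) {Q : ℕ → ℕ → ℝ} (hQ : IsGT n (blattner n m Λ) Q) {idx : List ℤ}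
    (hidx : ∀ j ∈ idx, 2 ≤ j ∧ j ≤ (n : ℤ) - 1 ∨ -(n : ℤ) + 1 ≤ j ∧ j ≤ -1) :
    (exponents n m μ ε Λ Q idx).IsIntegral := by
  have h2 := exists_two_mul_of_mem_Xi hΛ (by omega)
  have hentry := fun i j => hQ.exists_eq_add_int (by omega)
    (exists_blattner_eq hΛ (by omega) (by simp; omega)) (i := i) (j := j)
  have heven : ∀ j : ℤ, j ≠ 0 → j.natAbs ≤ n - 1 → ∃ k : ℤ, alphaAt n ε Λ Q j = k := by
    intro j hj0 hj
    obtain ⟨k, hk⟩ := exists_int_sign_mul_add h2 ε (exists_lEven_eq hj0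
      (hentry (2 * (n - 1)) j.natAbs (by simp; omega) (by simp; omega)))
    exact ⟨k - 1, by rw [alphaAt]; push_cast; linarith⟩
  have hodd : ∀ j : ℤ, j ≠ 0 → j.natAbs ≤ n - 1 →
      ∃ k : ℤ, ((ε : ℤ) : ℝ) * Λ n + lOdd (n - 1) Q j = k := fun j hj0 hj =>
    exists_int_sign_mul_add h2 ε (exists_lOdd_eq hj0
      (hentry (2 * (n - 1) - 1) j.natAbs (by simp; omega) (by simp; omega)))
  have hx : ∃ k : ℤ, ((ε : ℤ) : ℝ) * Λ n + ((ε : ℤ) : ℝ) * Λ (n + 1) = k := by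
    obtain ⟨l, hl⟩ := exists_eq_add_int_of_mem_Xi hΛ (by omega) (i := n + 1) (by simp)
    refine exists_int_sign_mul_add h2 ε ?_
    rcases Int.units_eq_one_or ε with rfl | rfl
    · exact ⟨l, Or.inl (by rw [hl]; push_cast; ring)⟩
    · exact ⟨-l, Or.inr (by rw [hl]; push_cast; ring)⟩
  have hy := heven ((m : ℤ) - 1) (by omega) (by omega)
  have hmem : ∀ p, 3 ≤ p → p ≤ idx.length + 2 → idx.getD (p - 3) 0 ∈ idx := by
    intro p h1 h2
    rw [List.getD_eq_getElem _ _ (by omega)]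
    exact List.getElem_mem _
  refine ⟨Nat.le_add_left _ _, fun p hp => ?_, fun p hp => ?_⟩
  · rw [Finset.mem_Icc] at hp
    rcases (by omega : p = 1 ∨ p = 2 ∨ 3 ≤ p) with rfl | rfl | h3
    · simp only [exponents, if_true]
      split_ifs
      · exact hx
      · rcases max_choice (((ε : ℤ) : ℝ) * Λ (n + 1)) (lEven (n - 1) Q ((m : ℤ) - 1) - 1) with h | h
        · rwa [h]
        · rwa [h]
    · simp only [exponents, if_true, OfNat.ofNat_ne_one, if_false]
      split_ifs
      · exact hy
      · rcases min_choice (((ε : ℤ) : ℝ) * Λ (n + 1)) (lEven (n - 1) Q ((m : ℤ) - 1) - 1) with h | h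
        · rwa [h]
        · rwa [h]
    · rw [exponents_α_of_three_le _ _ _ _ _ _ _ h3]
      have := hidx _ (hmem p h3 hp.2)
      exact heven _ (by omega) (by omega)
  · rw [Finset.mem_Icc] at hp
    have := hidx _ (hmem p hp.1 hp.2)
    simp only [exponents]
    split_ifs
    · exact hodd _ (by omega) (by omega)
    · exact hodd _ (by omega) (by omega)

theorem alphaAt_congr {n : ℕ} {ε : ℤˣ} {Λ : ℕ → ℝ} {Q Q' : ℕ → ℕ → ℝ} {j : ℤ}
    (h : Q (2 * n - 2) j.natAbs = Q' (2 * n - 2) j.natAbs) :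
    alphaAt n ε Λ Q j = alphaAt n ε Λ Q' j := by
  have e : 2 * (n - 1) = 2 * n - 2 := by omega
  rw [alphaAt, alphaAt, lEven, lEven, e, h]

theorem betaAt_congr {n : ℕ} {ε : ℤˣ} {Λ : ℕ → ℝ} {Q Q' : ℕ → ℕ → ℝ} {j : ℤ}
    (h : 0 < j → Q (2 * n - 3) (j - 1).natAbs = Q' (2 * n - 3) (j - 1).natAbs)
    (h' : j ≤ 0 → Q (2 * n - 3) j.natAbs = Q' (2 * n - 3) j.natAbs) :
    betaAt n ε Λ Q j = betaAt n ε Λ Q' j := by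
  have e : 2 * (n - 1) - 1 = 2 * n - 3 := by omega
  rw [betaAt, betaAt]
  split_ifs with hj
  · rw [lOdd, lOdd, e, h hj]
  · rw [lOdd, lOdd, e, h' (not_lt.1 hj)]

namespace IsAdjacent

variable {n m m' : ℕ} {lam : ℕ → ℝ} {Qp Qm : ℕ → ℕ → ℝ}

theorem alphaAt_eq (h : IsAdjacent n m m' lam Qp Qm) (ε : ℤˣ) (Λ : ℕ → ℝ) {j : ℤ}
    (hj : j ∈ increasingNumbering n m m' lam Qp) :
    alphaAt n ε Λ Qp j = alphaAt n ε Λ Qm j := by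
  obtain ⟨h2, hle, hlt⟩ := And.intro h.two_le (And.intro h.le h.lt)
  refine alphaAt_congr ?_
  rcases h.mem_increasingNumbering hj with h1 | h1
  · exact h.even_left _ (by omega) (by omega)
  · exact h.even_right _ (by omega) (by omega)

theorem betaAt_eq (h : IsAdjacent n m m' lam Qp Qm) (ε : ℤˣ) (Λ : ℕ → ℝ) {j : ℤ}
    (hj : j ∈ increasingNumbering n m m' lam Qp) :
    betaAt n ε Λ Qp j = betaAt n ε Λ Qm j := by
  obtain ⟨h2, hle, hlt⟩ := And.intro h.two_le (And.intro h.le h.lt)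
  rcases h.mem_increasingNumbering hj with h1 | h1
  · exact betaAt_congr (fun _ => h.odd_left _ (by omega) (by omega)) (by omega)
  · exact betaAt_congr (by omega) (fun _ => h.odd_right _ (by omega) (by omega))

/-- In both patterns `q_{2n-2,m-1} = λ_m`, so `y = Λ_m`, which is at most `x = ±Λ_{n+1}`. The
ordering by `max` and `min` at `m' - 1 = m - 1` thus changes nothing. -/
theorem exponents_α_one_two (h : IsAdjacent n m m' lam Qp Qm) {ε : ℤˣ} {Λ : ℕ → ℝ}
    (hΛ : Λ ∈ Xi n m ε) (hlam : lam = blattner n m Λ) (idx idx' : List ℤ) {p : ℕ}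
    (hp : p = 1 ∨ p = 2) :
    (exponents n m m' ε Λ Qp idx).α p = (exponents n m (m' - 1) ε Λ Qm idx').α p := by
  obtain ⟨h2, hle, hlt⟩ := And.intro h.two_le (And.intro h.le h.lt)
  have e : 2 * (n - 1) = 2 * n - 2 := by omega
  have hy : ∀ Q : ℕ → ℕ → ℝ, Q (2 * n - 2) (m - 1) = lam m →
      lEven (n - 1) Q ((m : ℤ) - 1) - 1 = Λ m := by
    intro Q hQ
    have e' : ((m : ℤ) - 1).natAbs = m - 1 := by omega
    rw [lEven, if_pos (by omega), e, e', hQ, hlam, blattner, if_neg (lt_irrefl m),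
      Nat.cast_sub (by omega), Nat.cast_sub (by omega)]
    push_cast
    ring
  have hle' := le_of_mem_Xi hΛ (by omega) (by omega)
  rcases hp with rfl | rfl <;>
  simp only [exponents, if_true, OfNat.ofNat_ne_one, if_false, hy _ h.even_first.1,
    hy _ h.even_first.2, hle, max_eq_left hle', min_eq_right hle', ite_self]

/-- The steps of the shift operator realize the quotient of the Gamma functions at the new index
`-m'`. -/
theorem prod_shift_eq (h : IsAdjacent n m m' lam Qp Qm) (ε : ℤˣ) (Λ : ℕ → ℝ) {k : ℕ}
    (hk : (k : ℝ) = lam m' - Qp (2 * n - 4) (m' - 1)) {s : ℂ}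
    (hs : 1 - (betaAt n ε Λ Qm (-(m' : ℤ)) : ℂ) - s ∈ offIntegers) :
    ∏ i ∈ Finset.range k, (s + ((((ε : ℤ) : ℝ) * Λ n - (Qp (2 * n - 4) (m' - 1) + i) - n + m' : ℝ) :
      ℂ)) = (-1) ^ k * (Complex.Gamma (-(alphaAt n ε Λ Qm (-(m' : ℤ)) : ℂ) - s) /
        Complex.Gamma (1 - (betaAt n ε Λ Qm (-(m' : ℤ)) : ℂ) - s)) := by
  obtain ⟨h2, hle, hlt⟩ := And.intro h.two_le (And.intro h.le h.lt)
  set z : ℂ := 1 - (betaAt n ε Λ Qm (-(m' : ℤ)) : ℂ) - s with hz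
  have eβ : betaAt n ε Λ Qm (-(m' : ℤ)) =
      ((ε : ℤ) : ℝ) * Λ n - (Qp (2 * n - 4) (m' - 1) + n - 1 - m') := by
    have e : 2 * (n - 1) - 1 = 2 * n - 3 := by omega
    rw [betaAt, if_neg (by omega), lOdd, Int.natAbs_neg, Int.natAbs_natCast, e, h.odd_mid.2,
      Int.sign_eq_neg_one_of_neg (by omega), Nat.cast_sub (by omega)]
    push_cast
    ring
  have eα : alphaAt n ε Λ Qm (-(m' : ℤ)) = ((ε : ℤ) : ℝ) * Λ n - (lam m' + n - m') := by
    have e : 2 * (n - 1) = 2 * n - 2 := by omega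
    rw [alphaAt, lEven, if_neg (by omega), if_pos (by omega), Int.natAbs_neg, Int.natAbs_natCast,
      e, h.even_mid.2, Nat.cast_sub (by omega)]
    push_cast
    ring
  -- The two Gamma arguments of the new index differ by the number of steps, so their quotient is
  -- the product of the `z + i`; each Euler factor is `-(z + i)`.
  have ez : -(alphaAt n ε Λ Qm (-(m' : ℤ)) : ℂ) - s = z + k := by
    have hk' : (k : ℂ) = ((k : ℝ) : ℂ) := by push_cast; rfl
    rw [hz, hk', hk, eα, eβ]
    push_cast
    ring
  have hne : ∀ i < k, z + (i : ℂ) ≠ 0 := fun i _ h0 => offIntegers_ne hs (-i) (by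
    push_cast
    linear_combination h0)
  rw [ez, Gamma_add_natCast_eq z k hne, mul_div_cancel_right₀ _ (Gamma_ne_zero_of_offIntegers hs)]
  have e : ∀ i ∈ Finset.range k, s + ((((ε : ℤ) : ℝ) * Λ n -
      (Qp (2 * n - 4) (m' - 1) + i) - n + m' : ℝ) : ℂ) = (-1) * (z + i) := fun i _ => by
    rw [hz, eβ]
    push_cast
    ring
  rw [Finset.prod_congr rfl e, Finset.prod_mul_distrib, Finset.prod_const, Finset.card_range]

/-- The effect of the shift operator for a numbering obtained from the increasing one by inserting
the new index `-m'`. -/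
theorem shiftsToNonzeroMultiple (h : IsAdjacent n m m' lam Qp Qm) {ε : ℤˣ} {Λ : ℕ → ℝ}
    (hΛ : Λ ∈ Xi n m ε) (hlam : lam = blattner n m Λ) {k : ℕ}
    (hk : (k : ℝ) = lam m' - Qp (2 * n - 4) (m' - 1)) {idx' : List ℤ}
    (hperm : idx'.Perm (-(m' : ℤ) :: increasingNumbering n m m' lam Qp)) {j j' : ℕ}
    (hj : j ∈ Finset.Icc 1 ((increasingNumbering n m m' lam Qp).length + 2))
    (hjj' : j < 3 ∧ j' = j ∨ 3 ≤ j ∧ 3 ≤ j' ∧ j' ≤ idx'.length + 2 ∧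
      (increasingNumbering n m m' lam Qp).getD (j - 3) 0 = idx'.getD (j' - 3) 0) (L : Kind) :
    ShiftsToNonzeroMultiple (shiftS2 n m' ε Λ lam Qp) L
      (exponents n m m' ε Λ Qp (increasingNumbering n m m' lam Qp)) j
      (exponents n m (m' - 1) ε Λ Qm idx') j' := by
  obtain ⟨h2, hle, hlt⟩ := And.intro h.two_le (And.intro h.le h.lt)
  set idx := increasingNumbering n m m' lam Qp with hidx_def
  have hidx : ∀ j ∈ idx, 2 ≤ j ∧ j ≤ (n : ℤ) - 1 ∨ -(n : ℤ) + 1 ≤ j ∧ j ≤ -1 := fun j hj => by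
    have := h.mem_increasingNumbering hj
    omega
  have hidx' : ∀ j ∈ idx', 2 ≤ j ∧ j ≤ (n : ℤ) - 1 ∨ -(n : ℤ) + 1 ≤ j ∧ j ≤ -1 := fun j hj => by
    rcases List.mem_cons.1 (hperm.mem_iff.1 hj) with rfl | hj
    · omega
    · exact hidx j hj
  have hD : (exponents n m m' ε Λ Qp idx).IsIntegral :=
    isIntegral_exponents hΛ h2 (by omega) (hlam ▸ h.gt_plus) hidx
  have hD' : (exponents n m (m' - 1) ε Λ Qm idx').IsIntegral :=
    isIntegral_exponents hΛ h2 (by omega) (hlam ▸ h.gt_minus) hidx'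
  have hlen : idx'.length = idx.length + 1 := by rw [hperm.length_eq, List.length_cons]
  have hfloor : ⌊lam m' - Qp (2 * n - 4) (m' - 1)⌋₊ = k := by rw [← hk, Nat.floor_natCast]
  rw [Finset.mem_Icc] at hj
  rw [shiftS2, hfloor]
  refine shiftsToNonzeroMultiple_of_gammaFactor hD hD' (σ := (-1) ^ k)
    (Finset.mem_Icc.2 hj) (Finset.mem_Icc.2 ?_) (by omega) ?_ _ k
    (pow_ne_zero _ (neg_ne_zero.2 one_ne_zero)) (fun s hs => ?_) L
  · change 1 ≤ j' ∧ j' ≤ idx'.length + 2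
    omega
  · rcases hjj' with ⟨h3, rfl⟩ | ⟨h3, h3', h4, h5⟩
    · exact h.exponents_α_one_two hΛ hlam _ _ (by omega)
    · rw [exponents_α_of_three_le _ _ _ _ _ _ _ h3, exponents_α_of_three_le _ _ _ _ _ _ _ h3', ← h5]
      refine h.alphaAt_eq ε Λ ?_
      rw [List.getD_eq_getElem _ _ (by omega)]
      exact List.getElem_mem _
  · have hβ : ∃ l : ℤ, betaAt n ε Λ Qm (-(m' : ℤ)) = l := by
      -- The index `-m'` occupies some place of the permuted list, so the integrality of its `β` is
      -- part of that of `D'`.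
      obtain ⟨i, hi, e⟩ := List.getElem_of_mem (hperm.mem_iff.2 List.mem_cons_self)
      have := hD'.β_int (i + 3) (by
        rw [Finset.mem_Icc]
        change 3 ≤ i + 3 ∧ i + 3 ≤ idx'.length + 2
        omega)
      rw [← e]
      simpa only [exponents, betaAt, Nat.add_sub_cancel, List.getD_eq_getElem _ _ hi] using this
    have hprod : (idx.map fun j => Complex.Gamma (-(alphaAt n ε Λ Qp j : ℂ) - s) /
        Complex.Gamma (1 - (betaAt n ε Λ Qp j : ℂ) - s)) =
        idx.map fun j => Complex.Gamma (-(alphaAt n ε Λ Qm j : ℂ) - s) /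
        Complex.Gamma (1 - (betaAt n ε Λ Qm j : ℂ) - s) :=
      List.map_congr_left fun j hj => by rw [h.alphaAt_eq ε Λ hj, h.betaAt_eq ε Λ hj]
    rw [gammaFactor_one_exponents, gammaFactor_one_exponents, (hperm.map _).prod_eq,
      List.map_cons, List.prod_cons, hprod,
      h.exponents_α_one_two hΛ hlam idx idx' (Or.inl rfl),
      h.exponents_α_one_two hΛ hlam idx idx' (Or.inr rfl),
      h.prod_shift_eq ε Λ hk (offIntegers_one_sub_sub hβ hs)]
    ring

end IsAdjacent

end SpinWhittaker

end

open SpinWhittaker in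
theorem mainTheorem10 (n m m' : ℕ) (hm : 2 ≤ m) (hmm' : m ≤ m') (hm'n : m' ≤ n - 1)
    (ε : ℤˣ) (Λ : ℕ → ℝ) (hΛ : Λ ∈ Xi n m ε)
    (lam : ℕ → ℝ) (hlam : lam = blattner n m Λ)
    (Qp Qm : ℕ → ℕ → ℝ)
    (hQp : IsQPlus n m m' lam Qp) (hQm : IsQMinus n m (m' - 1) lam Qm)
    (hrows : ∀ i ∈ Finset.Icc 1 (2 * n - 4), ∀ k ∈ Finset.Icc 1 ((i + 1) / 2), Qp i k = Qm i k)
    (hlt : Qp (2 * n - 4) (m' - 1) < lam m') (L : Kind) :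
    -- numbering of the data of `Q_{m'-1}^-` in which `-m'` occupies the place `N_1 + 1`
    (∀ j ∈ Finset.Icc 1 (N1 n m m' lam Qp),
      ShiftsToNonzeroMultiple (shiftS2 n m' ε Λ lam Qp) L
        (exponents n m m' ε Λ Qp (increasingNumbering n m m' lam Qp)) j
        (exponents n m (m' - 1) ε Λ Qm (frontNumbering n m (m' - 1) lam Qm)) j) ∧
    (∀ j ∈ Finset.Icc (N1 n m m' lam Qp + 1) (N2 n m m' lam Qp),
      ShiftsToNonzeroMultiple (shiftS2 n m' ε Λ lam Qp) L
        (exponents n m m' ε Λ Qp (increasingNumbering n m m' lam Qp)) j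
        (exponents n m (m' - 1) ε Λ Qm (frontNumbering n m (m' - 1) lam Qm)) (j + 1)) ∧
    -- increasing numbering of the data of `Q_{m'-1}^-`
    (∀ j ∈ Finset.Icc 1 (N2 n m m' lam Qp),
      ShiftsToNonzeroMultiple (shiftS2 n m' ε Λ lam Qp) L
        (exponents n m m' ε Λ Qp (increasingNumbering n m m' lam Qp)) j
        (exponents n m (m' - 1) ε Λ Qm (increasingNumbering n m (m' - 1) lam Qm)) j) := by
  have h := isAdjacent_of_isQPlus_of_isQMinus hm hmm' hm'n hQp hQm hrows
  have hint : ∀ i ∈ Finset.Icc 1 n, ∃ k : ℤ, lam i = Λ n + k := fun i hi =>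
    hlam ▸ exists_blattner_eq hΛ (by omega) hi
  -- Both entries are congruent to `Λ_n` modulo integers, so the positive gap is a natural number,
  -- and hence at least `1`.
  have hk : ∃ k : ℕ, (k : ℝ) = lam m' - Qp (2 * n - 4) (m' - 1) := by
    obtain ⟨a, ha⟩ := hint m' (by simp; omega)
    obtain ⟨b, hb⟩ := hQp.1.isGT.exists_eq_add_int (by omega)
      (hint n (by simp; omega)) (i := 2 * n - 4) (j := m' - 1)
      (by simp; omega) (by simp; omega)
    rw [ha, hb] at hlt
    have hlt' : b < a := by exact_mod_cast (add_lt_add_iff_left _).1 hlt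
    obtain ⟨k, hk⟩ := Int.eq_ofNat_of_zero_le (sub_nonneg.2 hlt'.le)
    have hk' : ((a - b : ℤ) : ℝ) = (k : ℝ) := by rw [hk]; norm_cast
    refine ⟨k, ?_⟩
    rw [ha, hb, ← hk']
    push_cast
    ring
  obtain ⟨k, hk⟩ := hk
  have hk1 : 1 ≤ k := by
    rcases Nat.eq_zero_or_pos k with rfl | h0
    · rw [Nat.cast_zero] at hk
      linarith
    · exact h0
  have hstep : Qp (2 * n - 4) (m' - 1) ≤ lam m' - 1 := by
    have : (1 : ℝ) ≤ k := by exact_mod_cast hk1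
    linarith
  have hlen : (increasingNumbering n m m' lam Qp).length + 2 = N2 n m m' lam Qp := by
    rw [increasingNumbering, List.length_append, N2, N1]
    omega
  have hfront := h.frontNumbering_eq hstep
  have hincr := h.increasingNumbering_eq hstep
  have hpf : (frontNumbering n m (m' - 1) lam Qm).Perm
      (-(m' : ℤ) :: increasingNumbering n m m' lam Qp) := hfront ▸ List.perm_middle
  have hpi : (increasingNumbering n m (m' - 1) lam Qm).Perm
      (-(m' : ℤ) :: increasingNumbering n m m' lam Qp) := hincr ▸ List.perm_append_singleton _ _
  have hlf := hpf.length_eq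
  have hli := hpi.length_eq
  rw [List.length_cons] at hlf hli
  refine ⟨fun j hj => ?_, fun j hj => ?_, fun j hj => ?_⟩ <;> rw [Finset.mem_Icc] at hj
  · have hN : N1 n m m' lam Qp ≤ N2 n m m' lam Qp := Nat.le_add_right _ _
    refine h.shiftsToNonzeroMultiple hΛ hlam hk hpf (Finset.mem_Icc.2 (by omega)) ?_ L
    rcases lt_or_ge j 3 with h3 | h3
    · exact Or.inl ⟨h3, rfl⟩
    · refine Or.inr ⟨h3, h3, by omega, ?_⟩
      have hj' : j - 3 < (jList n m m' lam Qp).length := by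
        have : N1 n m m' lam Qp = (jList n m m' lam Qp).length + 2 := rfl
        omega
      rw [hfront, increasingNumbering, List.getD_append _ _ _ _ hj', List.getD_append _ _ _ _ hj']
  · have hN : N1 n m m' lam Qp = (jList n m m' lam Qp).length + 2 := rfl
    refine h.shiftsToNonzeroMultiple hΛ hlam hk hpf (Finset.mem_Icc.2 (by omega))
      (Or.inr ⟨by omega, by omega, by omega, ?_⟩) L
    -- Past the positive indices the inserted `-m'` pushes every element one place further, which
    -- accounts for `j + 1`.
    rw [hfront, increasingNumbering, List.getD_append_right _ _ _ _ (by omega),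
      List.getD_append_right _ _ _ _ (by omega),
      show j + 1 - 3 - (jList n m m' lam Qp).length =
        j - 3 - (jList n m m' lam Qp).length + 1 by omega, List.getD_cons_succ]
  · refine h.shiftsToNonzeroMultiple hΛ hlam hk hpi (Finset.mem_Icc.2 (by omega)) ?_ L
    rcases lt_or_ge j 3 with h3 | h3
    · exact Or.inl ⟨h3, rfl⟩
    · refine Or.inr ⟨h3, h3, by omega, ?_⟩
      rw [hincr, List.getD_append _ _ _ _ (by omega)]
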